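/- Let $\mathbb F$ be a field of characteristic $p\ge 0$, let $n\ge 0$, and let $\lambda$ be a partition of $n$ with conjugate $\lambda'$. Put $\mathfrak l(\lambda):=n-\lambda_1$ (the level of $\lambda$; $\lambda_1=0$ if $n=0$). Let $S^\lambda$ be the Specht module over $\mathbb F\mathfrak S_n$ in the sense of James: the span of all polytabloids in the permutation module on the $\lambda$-tabloids. For a nonzero finite-dimensional $\mathbb F\mathfrak S_n$-module $V$: * if $p\ne 2$, the $2$-rank $\mathfrak r_2(V)$ is the largest $r$ such that there are distinct $i_1,j_1,\dots,i_r,j_r\in\{1,\dots,n\}$ and a nonzero $v\in V$ with $(i_a,j_a)v=-v$ for all $a$; * if $p\ne 3$ and $\mathbb F$ contains a primitive cube root of unity $\zeta$, the $3$-rank $\mathfrak r_3(V)$ is the largest $r$ such that there are distinct $i_1,j_1,k_1,\dots,i_r,j_r,k_r\in\{1,\dots,n\}$ and a nonzero $v\in V$ with $(i_a,j_a,k_a)v=\zeta v$ for all $a$; * if $p\ne 3$ and $\mathbb F$ is arbitrary, put $l=\lfloor n/3\rfloor$ and let $E_3=\mathfrak S_3\times\dots\times\mathfrak S_3\times\mathfrak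 S_{n-3l}\le\mathfrak S_n$ be the standard Young subgroup with $l$ factors $\mathfrak S_3$. Then $\mathfrak r_3(V)$ is the maximum, over the composition factors $L=L_1\boxtimes\dots\boxtimes L_l\boxtimes L_{l+1}$ of the restriction of $V$ to $E_3$, of the number of $a\le l$ such that $L_a$ is isomorphic to the two-dimensional irreducible module $D^{(2,1)}=S^{(2,1)}$ of $\mathfrak S_3$. Then: 1. If $p\neq 2$, then $\mathfrak r_2(S^\lambda)=\min\{\mathfrak l(\lambda),\lfloor n/2\rfloor\}$. 2. If $p\neq 3$, then $\mathfrak r_3(S^\lambda)=\min\{\mathfrak l(\lambda),\mathfrak l(\lambda'),\lfloor n/3\rfloor\}$. This holds for $\mathfrak r_3$ defined through $E_3$ over every such field $\mathbb F$, and, if $\mathbb F$ contains a primitive cube root of unity, also for $\mathfrak r_3$ defined through any such root $\zeta$. In particular (the case $p=0$), both formulas hold in characteristic $0$. -/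

import Mathlib

open Equiv

namespace SymmetricRank

universe u v

/-- The level of a partition: its size minus its first part. Partitions of `n` are identified with
their Young diagrams (with `n` cells), whose row lengths are the parts. -/
def level (μ : YoungDiagram) : ℕ := μ.card - μ.rowLen 0

/-! ### Specht modules -/

/-- A `μ`-tableau: a bijective filling of the cells of `μ` (pairs (row, column)) by the `n` letters;
`t.symm x` is the cell that contains the letter `x`. -/
abbrev Tableau (n : ℕ) (μ : YoungDiagram) : Type := μ.cells ≃ Fin n

/-- The row of the letter `x` in the tableau `t`. -/
def Tableau.row {n : ℕ} {μ : YoungDiagram} (t : Tableau n μ) (x : Fin n) : ℕ := (t.symm x).1.1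

/-- The column of the letter `x` in the tableau `t`. -/
def Tableau.col {n : ℕ} {μ : YoungDiagram} (t : Tableau n μ) (x : Fin n) : ℕ := (t.symm x).1.2

/-- The tableau obtained by applying the permutation `g` to every entry of `t`. -/
def Tableau.act {n : ℕ} {μ : YoungDiagram} (g : Perm (Fin n)) (t : Tableau n μ) : Tableau n μ :=
  t.trans g

/-- Row equivalence: every letter lies in the same row of both tableaux. -/
def tableauSetoid (n : ℕ) (μ : YoungDiagram) : Setoid (Tableau n μ) where
  r s t := ∀ x, s.row x = t.row x
  iseqv := ⟨fun _ _ => rfl, fun h x => (h x).symm, fun h k x => (h x).trans (k x)⟩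

/-- Tabloids: row equivalence classes of tableaux. -/
abbrev Tabloid (n : ℕ) (μ : YoungDiagram) : Type := Quotient (tableauSetoid n μ)

/-- The action of the symmetric group on tabloids. -/
def Tabloid.act {n : ℕ} {μ : YoungDiagram} (g : Perm (Fin n)) : Tabloid n μ → Tabloid n μ :=
  Quotient.map (sa := tableauSetoid n μ) (sb := tableauSetoid n μ) (Tableau.act g)
     (fun _ _ h x => h (g.symm x))

theorem Tabloid.act_one {n : ℕ} {μ : YoungDiagram} (t : Tabloid n μ) : t.act 1 = t := by
  induction t using Quotient.inductionOn
  rfl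

theorem Tabloid.act_mul {n : ℕ} {μ : YoungDiagram} (g h : Perm (Fin n)) (t : Tabloid n μ) :
    t.act (g * h) = (t.act h).act g := by
  induction t using Quotient.inductionOn
  rfl

/-- The permutation module `M^μ` with basis the tabloids. -/
noncomputable def tabloidRep (F : Type u) [Field F] (n : ℕ) (μ : YoungDiagram) :
    Representation F (Perm (Fin n)) (Tabloid n μ →₀ F) where
  toFun g := Finsupp.lmapDomain F F (Tabloid.act g)
  map_one' := by
    ext t : 2
    simp [Tabloid.act_one]
  map_mul' g h := by
    ext t : 2
    simp [Tabloid.act_mul]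

/-- The column stabilizer of a tableau. -/
def columnStabilizer {n : ℕ} {μ : YoungDiagram} (t : Tableau n μ) : Finset (Perm (Fin n)) :=
  Finset.univ.filter fun π => ∀ x, t.col (π x) = t.col x

/-- The polytabloid of `t`: the sum of `sign π • {π t}` over the column stabilizer of `t`. -/
noncomputable def polytabloid (F : Type u) [Field F] {n : ℕ} {μ : YoungDiagram}
    (t : Tableau n μ) : Tabloid n μ →₀ F :=
  ∑ π ∈ columnStabilizer t, Finsupp.single (Quotient.mk (tableauSetoid n μ) (t.act π)) ((Perm.sign π : ℤ) : F)

theorem tabloidRep_polytabloid (F : Type u) [Field F] {n : ℕ} {μ : YoungDiagram}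
    (g : Perm (Fin n)) (t : Tableau n μ) :
    tabloidRep F n μ g (polytabloid F t) = polytabloid F (t.act g) := by
  unfold polytabloid
  rw [map_sum]
  refine Finset.sum_bij' (fun π _ => g * π * g⁻¹) (fun π _ => g⁻¹ * π * g) ?_ ?_ ?_ ?_ ?_
  · intro π hπ
    simp only [columnStabilizer, Finset.mem_filter, Finset.mem_univ, true_and] at hπ ⊢
    intro x
    simpa [Tableau.col, Tableau.act] using! hπ (g⁻¹ x)
  · intro π hπ
    simp only [columnStabilizer, Finset.mem_filter, Finset.mem_univ, true_and] at hπ ⊢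
    intro x
    simpa [Tableau.col, Tableau.act] using! hπ (g x)
  · intro π _
    group
  · intro π _
    group
  · intro π _
    have h : (t.act g).act (g * π * g⁻¹) = (t.act π).act g := by
      ext x
      simp [Tableau.act]
    have hs : Perm.sign (g * π * g⁻¹) = Perm.sign π := by
      rw [Perm.sign_mul, Perm.sign_mul, Perm.sign_inv, mul_right_comm, Int.units_mul_self, one_mul]
    rw [h, hs]
    exact Finsupp.mapDomain_single

/-- The Specht module `S^μ`, as a subrepresentation of `M^μ`: the span of all polytabloids. -/
noncomputable def spechtSub (F : Type u) [Field F] (n : ℕ) (μ : YoungDiagram) :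
    Subrepresentation (tabloidRep F n μ) where
  toSubmodule := Submodule.span F (Set.range fun t : Tableau n μ => polytabloid F t)
  apply_mem_toSubmodule g v hv := by
    induction hv using Submodule.span_induction with
    | mem x hx =>
      obtain ⟨t, rfl⟩ := hx
      exact Submodule.subset_span ⟨t.act g, (tabloidRep_polytabloid F g t).symm⟩
    | zero => simp
    | add x y _ _ hx hy => simpa using Submodule.add_mem _ hx hy
    | smul a x _ hx => simpa using Submodule.smul_mem _ a hx

/-- The underlying vector space of the Specht module `S^μ`. -/
abbrev SpechtModule (F : Type u) [Field F] (n : ℕ) (μ : YoungDiagram) : Type u :=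
  (spechtSub F n μ).toSubmodule

/-- The Specht module `S^μ` as a representation of the symmetric group. -/
noncomputable def specht (F : Type u) [Field F] (n : ℕ) (μ : YoungDiagram) :
    Representation F (Perm (Fin n)) (SpechtModule F n μ) :=
  (spechtSub F n μ).toRepresentation

/-! ### Ranks through simultaneous eigenvectors -/

/-- `r` is the `2`-rank of `ρ`: the largest number of pairwise disjoint transpositions
`(i₁,j₁), …, (i_r,j_r)` (with `i_a = x (a, 0)` and `j_a = x (a, 1)`) that have a common nonzero
`(-1)`-eigenvector. -/
def IsTwoRank {F : Type u} [Field F] {n : ℕ} {V : Type v} [AddCommGroup V] [Module F V]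
    (ρ : Representation F (Perm (Fin n)) V) (r : ℕ) : Prop :=
  IsGreatest {s : ℕ | ∃ x : Fin s × Fin 2 → Fin n, Function.Injective x ∧ ∃ w : V, w ≠ 0 ∧
    ∀ a, ρ (swap (x (a, 0)) (x (a, 1))) w = -w} r

/-- `r` is the `3`-rank of `ρ`, defined through the cube root of unity `ζ`: the largest number of
pairwise disjoint `3`-cycles `(i₁,j₁,k₁), …, (i_r,j_r,k_r)` that have a common nonzero
`ζ`-eigenvector. Here `(i,j,k) = (i,j)(j,k)` is the cycle `i ↦ j ↦ k ↦ i`. -/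
def IsThreeRankAt {F : Type u} [Field F] {n : ℕ} {V : Type v} [AddCommGroup V] [Module F V]
    (ζ : F) (ρ : Representation F (Perm (Fin n)) V) (r : ℕ) : Prop :=
  IsGreatest {s : ℕ | ∃ x : Fin s × Fin 3 → Fin n, Function.Injective x ∧ ∃ w : V, w ≠ 0 ∧
    ∀ a, ρ (swap (x (a, 0)) (x (a, 1)) * swap (x (a, 1)) (x (a, 2))) w = ζ • w} r

/-! ### The `3`-rank over an arbitrary field of characteristic other than `3` -/

/-- The standard Young subgroup `S_3 × ⋯ × S_3 × S_{n - 3⌊n/3⌋}` of `S_n`: the permutations that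
preserve each of the consecutive blocks `{0,1,2}, {3,4,5}, …` (the last one may be shorter). -/
def youngE3 (n : ℕ) : Subgroup (Perm (Fin n)) where
  carrier := {g | ∀ x, (g x : ℕ) / 3 = (x : ℕ) / 3}
  one_mem' := fun _ => rfl
  mul_mem' := fun {g h} hg hh x => (hg (h x)).trans (hh x)
  inv_mem' := fun {g} hg x => by simpa using (hg (g⁻¹ x)).symm

/-- The embedding of `{0,1,2}` onto the block `{3a, 3a+1, 3a+2}`. -/
def blockEmb (n : ℕ) (a : Fin (n / 3)) : Fin 3 ↪ Fin n where
  toFun i := ⟨3 * a + i, by omega⟩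
  inj' i j h := by
    simp only [Fin.mk.injEq] at h
    omega

theorem viaEmbedding_mem_youngE3 (n : ℕ) (a : Fin (n / 3)) (g : Perm (Fin 3)) :
    Perm.viaEmbeddingHom (blockEmb n a) g ∈ youngE3 n := by
  intro x
  rw [Perm.viaEmbeddingHom_apply]
  by_cases hx : x ∈ Set.range (blockEmb n a)
  · obtain ⟨i, rfl⟩ := hx
    rw [Perm.viaEmbedding_apply]
    change (3 * (a : ℕ) + (g i : ℕ)) / 3 = (3 * (a : ℕ) + (i : ℕ)) / 3
    omega
  · rw [Perm.viaEmbedding_apply_of_notMem _ _ _ hx]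

/-- The inclusion of the `a`-th factor `S_3` into the Young subgroup. -/
noncomputable def factorHom (n : ℕ) (a : Fin (n / 3)) : Perm (Fin 3) →* youngE3 n :=
  (Perm.viaEmbeddingHom (blockEmb n a)).codRestrict (youngE3 n) (viaEmbedding_mem_youngE3 n a)

/-- The partition `(2,1)` of `3`. -/
def shape21 : YoungDiagram := YoungDiagram.ofRowLens [2, 1] (by simp [List.sortedGE_iff_pairwise])

/-- The type of an irreducible representation `L = L₁ ⊠ ⋯ ⊠ L_l ⊠ L_{l+1}` of the Young subgroup:
the number of `a ≤ l = ⌊n/3⌋` such that `L_a` is the two-dimensional irreducible representation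
`D^(2,1)` of `S_3`, which is the Specht module `S^(2,1)` when the characteristic is not `3`.
The restriction of `L` to the `a`-th factor is a direct sum of copies of the irreducible
representation `L_a`, so `L_a ≅ D^(2,1)` means that `D^(2,1)` embeds into this restriction. -/
noncomputable def typeE3 {F : Type u} [Field F] {n : ℕ} {L : Type v} [AddCommGroup L] [Module F L]
    (σ : Representation F (youngE3 n) L) : ℕ :=
  Nat.card {a : Fin (n / 3) // ∃ f : Representation.IntertwiningMap (specht F 3 shape21)
    (σ.comp (factorHom n a)), Function.Injective f}

/-- `σ` is a composition factor of `ρ`: it is irreducible and a quotient of a subrepresentation. -/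
def IsCompositionFactor {F : Type u} [Field F] {G : Type*} [Group G] {V L : Type v}
    [AddCommGroup V] [Module F V] [AddCommGroup L] [Module F L]
    (σ : Representation F G L) (ρ : Representation F G V) : Prop :=
  σ.IsIrreducible ∧ ∃ (B : Subrepresentation ρ)
    (f : Representation.IntertwiningMap B.toRepresentation σ), Function.Surjective f

/-- `r` is the `3`-rank of `ρ`, over a field of characteristic other than `3` that need not contain
a primitive cube root of unity: the largest type of a composition factor of the restriction of `ρ`
to the Young subgroup. -/
def IsThreeRank {F : Type u} [Field F] {n : ℕ} {V : Type v} [AddCommGroup V] [Module F V]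
    (ρ : Representation F (Perm (Fin n)) V) (r : ℕ) : Prop :=
  IsGreatest {s : ℕ | ∃ (L : Type v) (_ : AddCommGroup L) (_ : Module F L)
    (σ : Representation F (youngE3 n) L),
    IsCompositionFactor σ (ρ.comp (youngE3 n).subtype) ∧ s = typeE3 σ} r

end SymmetricRank

/-! Both 3-ranks reduce to one question: for how many disjoint 3-cycles `c` can a nonzero vector be
killed by all the sums `N(c) = 1 + c + c²` (`cycSum`)? If `ζ` exists, `1 + X + X² = (X - ζ)(X -
ζ²)`, so such a vector can be replaced by an eigenvector with eigenvalues `ζ` and `ζ²`, and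
inverting some cycles makes them all `ζ`. For `E_3`, the operator `N(c)` of a block commutes with
the group, and it vanishes on an irreducible module exactly when that factor is `D^(2,1)`. As 3 is
invertible, solutions of `N(c) w = 0` lift from quotients to submodules.

Upper bounds. Take a tabloid with nonzero coefficient in the vector. If a whole pair or triple lay
in its first row, the tabloid would be fixed and its coefficient multiplied by 2 or 3 would vanish.
So every pair or triple uses one of the `𝔩(λ)` letters outside that row. For triples, the product of
the projections `1 - N(c)/3` fixes the vector, but it kills any polytabloid whose first column
contains a whole triple, since 3-cycles are even. With more than `𝔩(λ')` triples this happens for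
every polytabloid.

Lower bounds. Apply `∏ (1 - g_b)` to a polytabloid, with `g_b` the chosen transpositions or
3-cycles; the result has the required relations, and the point is that it is nonzero. The cells are
grouped by labels weakly increasing down the columns (`fillable_pair`, `fillable_triple`). Each
`g_b` moves only letters of one label, and it moves a letter that is the only one of its label in
its column to another row. A rearrangement inequality (`labels_invariant`) shows that a column
permutation acting on the tabloid like a label preserving permutation preserves labels itself. Hence
no other term of the product contributes to the tabloid one starts from, and its coefficient is 1 in
every characteristic (`noncommProd_polytabloid_apply`). -/

namespace SymmetricRank

universe u v

/-! ### Labelled fillings of columns of prescribed heights -/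

/-- The diagram with column heights `h` has a filling by labels `0, …, r`, weakly increasing down
the columns, in which each of the labels `1, …, r` occurs exactly `k` times, in cells with property
`Q`. -/
def Fillable {k : ℕ} (Q : (Fin k → ℕ × ℕ) → Prop) (r : ℕ) (h : ℕ → ℕ) : Prop :=
  ∃ (T : ℕ × ℕ → ℕ) (x : Fin r → Fin k → ℕ × ℕ),
    (∀ i i' j, i ≤ i' → i' < h j → T (i, j) ≤ T (i', j)) ∧
    (∀ c, c.1 < h c.2 → T c ≤ r) ∧
    (∀ (a : Fin r) i, (x a i).1 < h (x a i).2) ∧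
    (∀ a, Function.Injective (x a)) ∧
    (∀ (a : Fin r) (c : ℕ × ℕ), c.1 < h c.2 → (T c = a + 1 ↔ ∃ i, x a i = c)) ∧
    ∀ a, Q (x a)

theorem Fillable.zero {k : ℕ} (Q : (Fin k → ℕ × ℕ) → Prop) (h : ℕ → ℕ) : Fillable Q 0 h :=
  ⟨fun _ => 0, fun a => a.elim0, by simp, by simp, fun a => a.elim0, fun a => a.elim0,
    fun a => a.elim0, fun a => a.elim0⟩

/-- The largest label goes to the cells cut off at the lower ends of the columns, so monotonicity
down the columns is automatic. The remaining heights need not come from a partition, which leaves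
the choice of columns free. -/
theorem Fillable.succ {k : ℕ} {Q : (Fin k → ℕ × ℕ) → Prop} {r : ℕ} {h h' : ℕ → ℕ}
    (hle : ∀ j, h' j ≤ h j) (y : Fin k → ℕ × ℕ) (hy : Function.Injective y)
    (hyc : ∀ c : ℕ × ℕ, (h' c.2 ≤ c.1 ∧ c.1 < h c.2) ↔ ∃ i, y i = c) (hQ : Q y)
    (H : Fillable Q r h') : Fillable Q (r + 1) h := by
  obtain ⟨T, x, h1, h2, h3, h4, h5, h6⟩ := H
  refine ⟨fun c => if c.1 < h' c.2 then T c else r + 1, Fin.snoc (α := fun _ => Fin k → ℕ × ℕ) x y,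
    ?_, ?_, ?_, ?_, ?_, ?_⟩
  · intro i i' j hi hi'
    dsimp only
    split_ifs with p q q
    · exact h1 i i' j hi q
    · exact (h2 _ p).trans (by omega)
    · omega
    · exact le_rfl
  · intro c hc
    dsimp only
    split_ifs with p
    · exact (h2 _ p).trans (by omega)
    · exact le_rfl
  · intro a i
    refine Fin.lastCases ?_ (fun a => ?_) a
    · simpa using ((hyc (y i)).2 ⟨i, rfl⟩).2
    · simpa using (h3 a i).trans_le (hle _)
  · intro a
    refine Fin.lastCases ?_ (fun a => ?_) a
    · simpa using hy
    · simpa using h4 a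
  · intro a c hc
    refine Fin.lastCases ?_ (fun a => ?_) a
    · rw [Fin.snoc_last, ← hyc c]
      dsimp only
      split_ifs with p
      · have := h2 c p
        simp only [Fin.val_last]
        omega
      · exact ⟨fun _ => ⟨not_lt.1 p, hc⟩, fun _ => by simp⟩
    · rw [Fin.snoc_castSucc]
      dsimp only
      split_ifs with p
      · simpa using h5 a c p
      · have := a.2
        simp only [Fin.val_castSucc]
        constructor
        · intro; omega
        · rintro ⟨i, rfl⟩
          exact absurd (h3 a i) p
  · intro a
    refine Fin.lastCases ?_ (fun a => ?_) a
    · simpa using hQ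
    · simpa using h6 a

theorem card_nonzero_le_sum (K : Finset ℕ) (h : ℕ → ℕ) :
    (K.filter fun j => h j ≠ 0).card ≤ ∑ j ∈ K, h j := by
  rw [Finset.card_filter]
  refine Finset.sum_le_sum fun j _ => ?_
  split_ifs <;> omega

theorem two_mul_card_nonzero_le_sum (K : Finset ℕ) (h : ℕ → ℕ) (h1 : ∀ j ∈ K, h j ≠ 1) :
    2 * (K.filter fun j => h j ≠ 0).card ≤ ∑ j ∈ K, h j := by
  rw [Finset.card_filter, Finset.mul_sum]
  refine Finset.sum_le_sum fun j hj => ?_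
  have := h1 j hj
  split_ifs <;> omega

theorem card_nonzero_erase (K : Finset ℕ) (h : ℕ → ℕ) {A : ℕ} (hA : A ∈ K) :
    (K.filter fun j => h j ≠ 0).card =
      (if h A ≠ 0 then 1 else 0) + ((K.erase A).filter fun j => h j ≠ 0).card := by
  simp only [Finset.card_filter]
  exact (Finset.add_sum_erase K _ hA).symm

theorem card_nonzero_add_le_sum (K : Finset ℕ) (h : ℕ → ℕ) (j : ℕ) (hj : j ∈ K) :
    (K.filter fun j => h j ≠ 0).card + h j ≤ ∑ j ∈ K, h j + 1 := by
  rw [card_nonzero_erase K h hj, ← Finset.add_sum_erase K _ hj]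
  have := card_nonzero_le_sum (K.erase j) h
  split_ifs <;> omega

theorem card_nonzero_congr (K : Finset ℕ) {h h' : ℕ → ℕ} (H : ∀ j ∈ K, h' j = h j) :
    (K.filter fun j => h' j ≠ 0).card = (K.filter fun j => h j ≠ 0).card := by
  rw [Finset.filter_congr fun j hj => by rw [H j hj]]

theorem exists_max_height (K : Finset ℕ) (h : ℕ → ℕ) (hK : 0 < ∑ j ∈ K, h j) :
    ∃ A ∈ K, ∀ j ∈ K, h j ≤ h A := by
  apply Finset.exists_max_image
  rw [Finset.nonempty_iff_ne_empty]
  rintro rfl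
  simp at hK

/-- Two cells in different rows. -/
def PairGood (y : Fin 2 → ℕ × ℕ) : Prop := (y 0).1 ≠ (y 1).1

/-- Three cells such that the last one is alone in its column and not in the row of the first. -/
def TripleGood (y : Fin 3 → ℕ × ℕ) : Prop :=
  (y 0).2 ≠ (y 2).2 ∧ (y 1).2 ≠ (y 2).2 ∧ (y 0).1 ≠ (y 2).1

theorem Fillable.pair_of_column {r : ℕ} {h : ℕ → ℕ} {A : ℕ} (hA : 2 ≤ h A)
    (H : Fillable PairGood r (fun j => if j = A then h A - 2 else h j)) :
    Fillable PairGood (r + 1) h := by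
  refine H.succ (fun j => ?_) ![(h A - 2, A), (h A - 1, A)] ?_ ?_ ?_
  · split_ifs with p
    · subst p; omega
    · exact le_rfl
  · intro i j hij
    fin_cases i <;> fin_cases j <;> simp_all <;> omega
  · rintro ⟨i, j⟩
    simp only [Fin.exists_fin_two, Matrix.cons_val_zero, Matrix.cons_val_one, Prod.mk.injEq]
    by_cases p : j = A
    · subst p; simp; omega
    · simp [p, Ne.symm p]
  · simp [PairGood]; omega

theorem Fillable.pair_of_columns {r : ℕ} {h : ℕ → ℕ} {A B : ℕ} (hB : 1 ≤ h B)
    (hAB : h B < h A)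
    (H : Fillable PairGood r (fun j => if j = A then h A - 1 else if j = B then h B - 1 else h j)) :
    Fillable PairGood (r + 1) h := by
  have hne : A ≠ B := by rintro rfl; omega
  refine H.succ (fun j => ?_) ![(h A - 1, A), (h B - 1, B)] ?_ ?_ ?_
  · split_ifs with p q
    · subst p; omega
    · subst q; omega
    · exact le_rfl
  · intro i j hij
    fin_cases i <;> fin_cases j <;> simp_all
  · rintro ⟨i, j⟩
    simp only [Fin.exists_fin_two, Matrix.cons_val_zero, Matrix.cons_val_one, Prod.mk.injEq]
    by_cases p : j = A
    · subst p; simp [hne.symm]; omega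
    · by_cases q : j = B
      · subst q; simp [p, hne]; omega
      · simp [p, q, Ne.symm p, Ne.symm q]
  · simp [PairGood]; omega

theorem Fillable.triple_of_two_columns {r : ℕ} {h : ℕ → ℕ} {A B : ℕ} (hne : A ≠ B) (hA : 2 ≤ h A)
    (hB : 1 ≤ h B)
    (H : Fillable TripleGood r
      (fun j => if j = A then h A - 2 else if j = B then h B - 1 else h j)) :
    Fillable TripleGood (r + 1) h := by
  have key : ∀ u v, u ≠ v → u ≠ h B - 1 → (∀ i, (h A - 2 ≤ i ∧ i < h A) ↔ u = i ∨ v = i) →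
      Fillable TripleGood (r + 1) h := by
    intro u v huv hu hi
    refine H.succ (fun j => ?_) ![(u, A), (v, A), (h B - 1, B)] ?_ ?_ ?_
    · split_ifs with p q
      · subst p; omega
      · subst q; omega
      · exact le_rfl
    · intro i j hij
      fin_cases i <;> fin_cases j <;> simp_all
    · rintro ⟨i, j⟩
      simp only [Fin.exists_fin_succ, Matrix.cons_val_zero, Matrix.cons_val_succ, Prod.mk.injEq]
      by_cases p : j = A
      · subst p
        have := hi i
        simp [hne.symm]
        omega
      · by_cases q : j = B
        · subst q; simp [p, hne]; omega
        · simp [p, q, Ne.symm p, Ne.symm q]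
    · simp [TripleGood, hne, hu]
  -- At most one of the two cells taken from column `A` lies in the row of the cell taken from `B`;
  -- the other one is listed first.
  by_cases hc : h A - 2 = h B - 1
  · exact key (h A - 1) (h A - 2) (by omega) (by omega) (fun i => by omega)
  · exact key (h A - 2) (h A - 1) (by omega) (by omega) (fun i => by omega)

theorem Fillable.triple_of_three_columns {r : ℕ} {h : ℕ → ℕ} {A B C : ℕ} (hBC : B ≠ C)
    (hA : 2 ≤ h A) (hB : h B = 1) (hC : h C = 1)
    (H : Fillable TripleGood r
      (fun j => if j = A then h A - 1 else if j = B then 0 else if j = C then 0 else h j)) :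
    Fillable TripleGood (r + 1) h := by
  have hAB : A ≠ B := by rintro rfl; omega
  have hAC : A ≠ C := by rintro rfl; omega
  refine H.succ (fun j => ?_) ![(h A - 1, A), (0, C), (0, B)] ?_ ?_ ?_
  · split_ifs with p q q
    · subst p; omega
    · omega
    · omega
    · exact le_rfl
  · intro i j hij
    fin_cases i <;> fin_cases j <;>
      simp [hAB, hAC, hBC, hAB.symm, hAC.symm, hBC.symm] at hij ⊢
  · rintro ⟨i, j⟩
    simp only [Fin.exists_fin_succ, Matrix.cons_val_zero, Matrix.cons_val_succ, Prod.mk.injEq]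
    by_cases p : j = A
    · subst p; simp [hAB.symm, hAC.symm]; omega
    · by_cases q : j = B
      · subst q; simp [p, hAB, hBC.symm, hB]; omega
      · by_cases q' : j = C
        · subst q'; simp [p, hAC, hBC, hC]; omega
        · simp [p, q, q', Ne.symm p, Ne.symm q, Ne.symm q']
  · simp [TripleGood, hAB, hBC.symm]; omega

/-- Greedy induction that always uses a highest column. The number of nonempty columns plays the
role of `λ₁`, so the second inequality says that `r` is at most the level. Removing a pair lowers
the total by 2 and `r` by 1, so when this inequality is tight a column has to be emptied. -/
theorem fillable_pair (J : Finset ℕ) (r : ℕ) : ∀ h : ℕ → ℕ, 2 * r ≤ ∑ j ∈ J, h j →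
    (J.filter fun j => h j ≠ 0).card + r ≤ ∑ j ∈ J, h j → Fillable PairGood r h := by
  induction r with
  | zero => exact fun h _ _ => Fillable.zero _ h
  | succ r ih =>
    intro h h1 h2
    obtain ⟨A, hAJ, hA⟩ := exists_max_height J h (by omega)
    have hA2 : 2 ≤ h A := by
      by_contra hlt
      have : ∑ j ∈ J, h j ≤ (J.filter fun j => h j ≠ 0).card := by
        rw [Finset.card_filter]
        refine Finset.sum_le_sum fun j hj => ?_
        have := hA j hj
        split_ifs <;> omega
      omega
    have eC := card_nonzero_erase J h hAJ
    have eS := Finset.add_sum_erase J h hAJ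
    have col (hyp : h A = 2 ∨ (J.filter fun j => h j ≠ 0).card + (r + 2) ≤ ∑ j ∈ J, h j) :
        Fillable PairGood (r + 1) h := by
      refine Fillable.pair_of_column hA2 (ih _ ?_ ?_)
      all_goals
        rw [← Finset.add_sum_erase J _ hAJ,
          Finset.sum_congr (g := fun j => h j) rfl fun j hj => if_neg (Finset.ne_of_mem_erase hj)]
      · simp only [if_true]
        omega
      · rw [card_nonzero_erase J _ hAJ, card_nonzero_congr (J.erase A)
          fun j hj => if_neg (Finset.ne_of_mem_erase hj)]
        simp only [if_true]
        split_ifs at * <;> omega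
    by_cases hC : (J.filter fun j => h j ≠ 0).card + (r + 2) ≤ ∑ j ∈ J, h j
    · exact col (Or.inr hC)
    by_cases hB : ∃ B ∈ J, h B = 1
    · obtain ⟨B, hBJ, hB⟩ := hB
      have hne : B ≠ A := by rintro rfl; omega
      have hBJ' : B ∈ J.erase A := Finset.mem_erase.2 ⟨hne, hBJ⟩
      have eC' := card_nonzero_erase _ h hBJ'
      have eS' := Finset.add_sum_erase _ h hBJ'
      have agree : ∀ j ∈ (J.erase A).erase B,
          (if j = A then h A - 1 else if j = B then h B - 1 else h j) = h j := fun j hj => by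
        rw [if_neg (Finset.ne_of_mem_erase (Finset.mem_of_mem_erase hj)),
          if_neg (Finset.ne_of_mem_erase hj)]
      refine Fillable.pair_of_columns (A := A) (B := B) (by omega) (by omega) (ih _ ?_ ?_)
      all_goals
        rw [← Finset.add_sum_erase J _ hAJ, ← Finset.add_sum_erase _ _ hBJ',
          Finset.sum_congr (g := fun j => h j) rfl agree]
      · simp only [if_true, hne, if_false]
        omega
      · rw [card_nonzero_erase J _ hAJ, card_nonzero_erase _ _ hBJ', card_nonzero_congr _ agree]
        simp only [if_true, hne, if_false]
        split_ifs at * <;> omega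
    · push Not at hB
      have e1 := two_mul_card_nonzero_le_sum J h hB
      have e2 := two_mul_card_nonzero_le_sum (J.erase A) h
        fun j hj => hB j (Finset.mem_of_mem_erase hj)
      refine col (Or.inl ?_)
      split_ifs at * <;> omega

/-- The same greedy induction with an additional bound on each single height, which stands for the
level of the conjugate. A triple lowers the total by 3 and `r` by 1, so the number of columns to be
emptied is at least 2 minus the slack of the second inequality. For `r = 0` the last two conditions
hold automatically. -/
theorem fillable_triple (J : Finset ℕ) (r : ℕ) : ∀ h : ℕ → ℕ, 3 * r ≤ ∑ j ∈ J, h j →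
    (r = 0 ∨ (J.filter fun j => h j ≠ 0).card + r ≤ ∑ j ∈ J, h j) →
    (r = 0 ∨ ∀ j ∈ J, h j + r ≤ ∑ j ∈ J, h j) → Fillable TripleGood r h := by
  induction r with
  | zero => exact fun h _ _ _ => Fillable.zero _ h
  | succ r ih =>
    intro h h1 h2 h3
    replace h2 := h2.resolve_left (by omega)
    replace h3 := h3.resolve_left (by omega)
    obtain ⟨A, hAJ, hA⟩ := exists_max_height J h (by omega)
    have hA2 : 2 ≤ h A := by
      by_contra hlt
      have : ∑ j ∈ J, h j ≤ (J.filter fun j => h j ≠ 0).card := by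
        rw [Finset.card_filter]
        refine Finset.sum_le_sum fun j hj => ?_
        have := hA j hj
        split_ifs <;> omega
      omega
    have h3A := h3 A hAJ
    have eC := card_nonzero_erase J h hAJ
    have eS := Finset.add_sum_erase J h hAJ
    -- Two cells from `A` and one from `B` are admissible if the slack is at least 2 and `B` is the
    -- highest remaining column, if the slack is 1 and `A` or `B` gets emptied, or if no further
    -- triple is needed.
    have two (B : ℕ) (hne : B ≠ A) (hBJ : B ∈ J) (hB : 1 ≤ h B)
        (hyp : (J.filter fun j => h j ≠ 0).card + (r + 3) ≤ ∑ j ∈ J, h j ∧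
            (∀ j ∈ J.erase A, h j ≤ h B) ∨
          (J.filter fun j => h j ≠ 0).card + (r + 2) = ∑ j ∈ J, h j ∧ (h B = 1 ∨ h A = 2) ∨
          r = 0) :
        Fillable TripleGood (r + 1) h := by
      have hBJ' : B ∈ J.erase A := Finset.mem_erase.2 ⟨hne, hBJ⟩
      have eC' := card_nonzero_erase _ h hBJ'
      have eS' := Finset.add_sum_erase _ h hBJ'
      have hAB := hA B hBJ
      have agree : ∀ j ∈ (J.erase A).erase B,
          (if j = A then h A - 2 else if j = B then h B - 1 else h j) = h j := fun j hj => by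
        rw [if_neg (Finset.ne_of_mem_erase (Finset.mem_of_mem_erase hj)),
          if_neg (Finset.ne_of_mem_erase hj)]
      have rest := card_nonzero_le_sum ((J.erase A).erase B) h
      refine Fillable.triple_of_two_columns hne.symm hA2 hB (ih _ ?_ ?_ ?_)
      all_goals
        rw [← Finset.add_sum_erase J _ hAJ, ← Finset.add_sum_erase _ _ hBJ',
          Finset.sum_congr (g := fun j => h j) rfl agree]
        simp only [if_true, hne, if_false]
      · omega
      · rw [card_nonzero_erase J _ hAJ, card_nonzero_erase _ _ hBJ', card_nonzero_congr _ agree]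
        simp only [if_true, hne, if_false]
        rcases hyp with hyp | hyp | hyp
        · split_ifs at * <;> omega
        · split_ifs at * <;> omega
        · exact Or.inl hyp
      · rcases Nat.eq_zero_or_pos r with hr | hr
        · exact Or.inl hr
        refine Or.inr fun j hj => ?_
        by_cases p : j = A
        · simp only [p, if_true]
          split_ifs at * <;> omega
        by_cases q : j = B
        · simp only [q, if_true, hne, if_false]
          split_ifs at * <;> omega
        have hjR : j ∈ (J.erase A).erase B :=
          Finset.mem_erase.2 ⟨q, Finset.mem_erase.2 ⟨p, hj⟩⟩
        have e1 := card_nonzero_add_le_sum _ h j hjR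
        have e2 := Finset.single_le_sum (f := h) (fun _ _ => Nat.zero_le _) hjR
        have e3 := hA j hj
        simp only [p, q, if_false]
        rcases hyp with hyp | hyp | hyp
        · have := hyp.2 j (Finset.mem_of_mem_erase hjR)
          split_ifs at * <;> omega
        · split_ifs at * <;> omega
        · omega
    obtain ⟨B, hBJ', hB⟩ := exists_max_height (J.erase A) h (by omega)
    have hBJ := Finset.mem_of_mem_erase hBJ'
    have hBA := Finset.ne_of_mem_erase hBJ'
    have hB1 : 1 ≤ h B := by
      by_contra hlt
      have : ∑ j ∈ J.erase A, h j = 0 :=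
        Finset.sum_eq_zero fun j hj => by have := hB j hj; omega
      omega
    rcases Nat.eq_zero_or_pos r with hr | hr
    · exact two B hBA hBJ hB1 (Or.inr (Or.inr hr))
    by_cases c1 : (J.filter fun j => h j ≠ 0).card + (r + 3) ≤ ∑ j ∈ J, h j
    · exact two B hBA hBJ hB1 (Or.inl ⟨c1, hB⟩)
    by_cases c2 : (J.filter fun j => h j ≠ 0).card + (r + 2) = ∑ j ∈ J, h j
    · by_cases hD : ∃ D ∈ J, h D = 1
      · obtain ⟨D, hDJ, hD⟩ := hD
        exact two D (by rintro rfl; omega) hDJ hD.ge (Or.inr (Or.inl ⟨c2, Or.inl hD⟩))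
      -- Slack 1 without columns of height 1 leaves only `r = 1` with three nonempty columns, all of
      -- height 2.
      · push Not at hD
        have e1 := two_mul_card_nonzero_le_sum J h hD
        have e2 := two_mul_card_nonzero_le_sum (J.erase A) h
          fun j hj => hD j (Finset.mem_of_mem_erase hj)
        refine two B hBA hBJ hB1 (Or.inr (Or.inl ⟨c2, Or.inr ?_⟩))
        split_ifs at * <;> omega
    -- No slack: two columns must be emptied at once. Counting shows that two columns of height 1
    -- exist, and the third cell comes from `A`.
    obtain ⟨D, hDJ, hD⟩ : ∃ D ∈ J, h D = 1 := by
      by_contra hD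
      push Not at hD
      have e1 := two_mul_card_nonzero_le_sum J h hD
      omega
    have hDA : D ≠ A := by rintro rfl; omega
    obtain ⟨E, hEJ', hE⟩ : ∃ E ∈ J.erase D, h E = 1 := by
      by_contra hE
      push Not at hE
      have e1 := two_mul_card_nonzero_le_sum (J.erase D) h hE
      have e2 := card_nonzero_erase J h hDJ
      have e3 := Finset.add_sum_erase J h hDJ
      split_ifs at * <;> omega
    have hEJ := Finset.mem_of_mem_erase hEJ'
    have hED := Finset.ne_of_mem_erase hEJ'
    have hEA : E ≠ A := by rintro rfl; omega
    have hDJ₂ : D ∈ J.erase A := Finset.mem_erase.2 ⟨hDA, hDJ⟩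
    have hEJ₂ : E ∈ (J.erase A).erase D := Finset.mem_erase.2 ⟨hED, Finset.mem_erase.2 ⟨hEA, hEJ⟩⟩
    have eC' := card_nonzero_erase _ h hDJ₂
    have eS' := Finset.add_sum_erase _ h hDJ₂
    have eC₂ := card_nonzero_erase _ h hEJ₂
    have eS₂ := Finset.add_sum_erase _ h hEJ₂
    have rest := card_nonzero_le_sum (((J.erase A).erase D).erase E) h
    have agree : ∀ j ∈ ((J.erase A).erase D).erase E,
        (if j = A then h A - 1 else if j = D then 0 else if j = E then 0 else h j) = h j :=
      fun j hj => by
        simp only [Finset.mem_erase] at hj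
        simp [hj]
    refine Fillable.triple_of_three_columns hED.symm hA2 hD hE (ih _ ?_ ?_ ?_)
    all_goals
      rw [← Finset.add_sum_erase J _ hAJ, ← Finset.add_sum_erase _ _ hDJ₂,
        ← Finset.add_sum_erase _ _ hEJ₂, Finset.sum_congr (g := fun j => h j) rfl agree]
      simp only [if_true, hDA, hEA, hED, if_false]
    · omega
    · rw [card_nonzero_erase J _ hAJ, card_nonzero_erase _ _ hDJ₂, card_nonzero_erase _ _ hEJ₂,
        card_nonzero_congr _ agree]
      simp only [if_true, hDA, hEA, hED, if_false]
      split_ifs at * <;> omega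
    · refine Or.inr fun j hj => ?_
      by_cases p : j = A
      · simp only [p, if_true]
        split_ifs at * <;> omega
      by_cases q : j = D
      · simp only [q, if_true, hDA, if_false]
        split_ifs at * <;> omega
      by_cases q' : j = E
      · simp only [q', if_true, hEA, if_false, hED]
        split_ifs at * <;> omega
      have hjR : j ∈ ((J.erase A).erase D).erase E :=
        Finset.mem_erase.2 ⟨q', Finset.mem_erase.2 ⟨q, Finset.mem_erase.2 ⟨p, hj⟩⟩⟩
      have e1 := card_nonzero_add_le_sum _ h j hjR
      have e3 := hA j hj
      simp only [p, q, q', if_false]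
      split_ifs at * <;> omega

theorem perm_apply_inv {α : Type*} (g : Perm α) (x : α) : g (g⁻¹ x) = x :=
  g.apply_symm_apply x

/-! ### Rows of tabloids and the rearrangement argument -/

section Tableaux

variable {n : ℕ} {μ : YoungDiagram}

theorem Tableau.ext_row_col (t : Tableau n μ) {x y : Fin n} (hr : t.row x = t.row y)
    (hc : t.col x = t.col y) : x = y :=
  t.symm.injective (Subtype.ext (Prod.ext hr hc))

/-- The row of the letter `x` in a tabloid. -/
def Tabloid.row (s : Tabloid n μ) (x : Fin n) : ℕ :=
  Quotient.lift (s := tableauSetoid n μ) (fun t : Tableau n μ => t.row x) (fun _ _ h => h x) s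

/-- The tabloid of a tableau. -/
def Tableau.tabloid (t : Tableau n μ) : Tabloid n μ := Quotient.mk (tableauSetoid n μ) t

@[simp] theorem Tableau.row_tabloid (t : Tableau n μ) (x : Fin n) :
    t.tabloid.row x = t.row x := rfl

theorem Tabloid.ext_row {s s' : Tabloid n μ} (h : ∀ x, s.row x = s'.row x) : s = s' := by
  induction s using Quotient.inductionOn
  induction s' using Quotient.inductionOn
  exact Quotient.sound (s := tableauSetoid n μ) h

theorem Tabloid.row_act (s : Tabloid n μ) (g : Perm (Fin n)) (x : Fin n) :
    (s.act g).row x = s.row (g⁻¹ x) := by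
  induction s using Quotient.inductionOn
  rfl

theorem exists_tableau (hμ : μ.card = n) : Nonempty (Tableau n μ) :=
  ⟨Fintype.equivFinOfCardEq (by simpa using hμ)⟩

/-- A column permutation that has the same effect on the rows as a label preserving permutation
preserves the labels, if these increase weakly down the columns. -/
theorem labels_invariant (t : Tableau n μ) (T : Fin n → ℕ)
    (hT : ∀ x y, t.col x = t.col y → t.row x ≤ t.row y → T x ≤ T y)
    {π g : Perm (Fin n)} (hπ : ∀ x, t.col (π x) = t.col x) (hg : ∀ x, T (g x) = T x)
    (h : ∀ x, t.row (π⁻¹ x) = t.row (g⁻¹ x)) (x : Fin n) : T (π x) = T x := by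
  -- As `π` and `g` have the same effect on rows and `g` preserves `T`, permuting the labels by `π`
  -- does not change their pairing with the rows.
  have e0 : ∑ x, T (π x) * t.row x = ∑ x, T x * t.row x := by
    calc ∑ x, T (π x) * t.row x = ∑ x, T x * t.row (π⁻¹ x) :=
          (Equiv.sum_comp π fun x => T x * t.row (π⁻¹ x)).symm.trans (by simp) |>.symm
      _ = ∑ x, T x * t.row (g⁻¹ x) := by simp only [h]
      _ = ∑ x, T (g x) * t.row (g⁻¹ (g x)) :=
          (Equiv.sum_comp g fun x => T x * t.row (g⁻¹ x)).symm
      _ = _ := by simp [hg]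
  have e1 : ∑ x, T (π x) * t.col x = ∑ x, T x * t.col x := by
    rw [← Equiv.sum_comp π fun x => T x * t.col x]
    simp only [hπ]
  -- Adding `K` times the column, with `K` above all labels and rows, separates the columns, so one
  -- rearrangement inequality handles all of them together.
  obtain ⟨K, hKT, hKr⟩ : ∃ K, (∀ x, T x < K) ∧ ∀ x, t.row x < K := by
    refine ⟨∑ x, T x + ∑ x, t.row x + 1, fun x => ?_, fun x => ?_⟩
    · have := Finset.single_le_sum (f := T) (fun _ _ => Nat.zero_le _) (Finset.mem_univ x)
      omega
    · have := Finset.single_le_sum (f := t.row) (fun _ _ => Nat.zero_le _) (Finset.mem_univ x)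
      omega
  set U : Fin n → ℕ := fun x => T x + K * t.col x with hU
  set R : Fin n → ℕ := fun x => t.row x + K * t.col x with hR
  have lt_col : ∀ x y, t.col x < t.col y → R x < R y ∧ U x < U y := by
    intro x y hxy
    have h1 : K * t.col x + K ≤ K * t.col y := by
      rw [← Nat.mul_succ]; exact Nat.mul_le_mul_left _ hxy
    have := hKT x
    have := hKr x
    simp only [hR, hU]
    omega
  have hmono : ∀ x y, R x ≤ R y → U x ≤ U y := by
    intro x y hxy
    rcases lt_trichotomy (t.col x) (t.col y) with hc | hc | hc
    · exact (lt_col x y hc).2.le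
    · simp only [hR, hU, hc] at hxy ⊢
      have := hT x y hc (by omega)
      omega
    · exact absurd (lt_col y x hc).1 (by omega)
  have mUR : Monovary U R := fun x y hxy => hmono x y hxy.le
  have e2 : ∑ x, U (π x) * R x = ∑ x, U x * R x := by
    have expand : ∀ σ : Perm (Fin n), (∀ x, t.col (σ x) = t.col x) → ∑ x, U (σ x) * R x =
        ∑ x, T (σ x) * t.row x + K * ∑ x, T (σ x) * t.col x +
          ∑ x, K * t.col x * (t.row x + K * t.col x) := by
      intro σ hσ
      rw [Finset.mul_sum, ← Finset.sum_add_distrib, ← Finset.sum_add_distrib]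
      refine Finset.sum_congr rfl fun x _ => ?_
      simp only [hU, hR, hσ]
      ring
    have := expand 1 (fun _ => rfl)
    simp only [Perm.one_apply] at this
    rw [expand π hπ, this, e0, e1]
  -- The equality case of the rearrangement inequality. It makes `U ∘ π` similarly ordered to `U`,
  -- so that `∑ (U (π x) - U x) ^ 2` vanishes.
  have mπ : Monovary (U ∘ π) R := (mUR.sum_comp_perm_mul_eq_sum_mul_iff).1 e2
  have mU : Monovary (U ∘ π) U := by
    intro x y hxy
    exact mπ (lt_of_not_ge fun hle => absurd (hmono y x hle) (by omega))
  have e3 : ∑ x, U (π x) * U x = ∑ x, U x * U x :=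
    ((monovary_self U).sum_comp_perm_mul_eq_sum_mul_iff).2 mU
  have e4 : ∑ x, ((U (π x) : ℤ) - U x) ^ 2 = 0 := by
    have e5 : ∑ x, (U (π x) : ℤ) * U (π x) = ∑ x, (U x : ℤ) * U x :=
      Equiv.sum_comp π fun x => (U x : ℤ) * U x
    have e6 : ∑ x, (U (π x) : ℤ) * U x = ∑ x, (U x : ℤ) * U x := by exact_mod_cast e3
    calc ∑ x, ((U (π x) : ℤ) - U x) ^ 2
        = ∑ x, (U (π x) : ℤ) * U (π x) - 2 * ∑ x, (U (π x) : ℤ) * U x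
            + ∑ x, (U x : ℤ) * U x := by
          rw [Finset.mul_sum, ← Finset.sum_sub_distrib, ← Finset.sum_add_distrib]
          exact Finset.sum_congr rfl fun x _ => by ring
      _ = 0 := by rw [e5, e6]; ring
  have e7 := (Finset.sum_eq_zero_iff_of_nonneg fun x _ => sq_nonneg _).1 e4 x (Finset.mem_univ x)
  have e8 : U (π x) = U x := by
    have := pow_eq_zero_iff (two_ne_zero) |>.1 e7
    omega
  simp only [hU, hπ] at e8
  omega

end Tableaux

/-! ### Coefficients of polytabloids and of their images -/

section Coefficients

variable {F : Type u} [Field F] {n : ℕ} {μ : YoungDiagram}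

theorem tabloidRep_apply (g : Perm (Fin n)) (w : Tabloid n μ →₀ F) (s : Tabloid n μ) :
    tabloidRep F n μ g w s = w (s.act g⁻¹) := by
  have hinj : Function.Injective (Tabloid.act (n := n) (μ := μ) g) :=
    Function.LeftInverse.injective (g := Tabloid.act g⁻¹) fun s => by
      rw [← Tabloid.act_mul, inv_mul_cancel, Tabloid.act_one]
  have : s = (s.act g⁻¹).act g := by rw [← Tabloid.act_mul, mul_inv_cancel, Tabloid.act_one]
  conv_lhs => rw [this]
  exact Finsupp.mapDomain_apply hinj _ _

theorem mem_columnStabilizer {t : Tableau n μ} {π : Perm (Fin n)} :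
    π ∈ columnStabilizer t ↔ ∀ x, t.col (π x) = t.col x := by
  simp [columnStabilizer]

theorem exists_of_polytabloid_ne_zero {t : Tableau n μ} {s : Tabloid n μ}
    (hs : polytabloid F t s ≠ 0) :
    ∃ π : Perm (Fin n), (∀ x, t.col (π x) = t.col x) ∧ s = t.tabloid.act π := by
  unfold polytabloid at hs
  rw [Finsupp.finsetSum_apply] at hs
  obtain ⟨π, hπ, hne⟩ := Finset.exists_ne_zero_of_sum_ne_zero hs
  refine ⟨π, mem_columnStabilizer.1 hπ, ?_⟩
  by_contra hcon
  exact hne (Finsupp.single_eq_of_ne hcon)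

theorem polytabloid_apply_self (t : Tableau n μ) : polytabloid F t t.tabloid = 1 := by
  unfold polytabloid
  rw [Finsupp.finsetSum_apply, Finset.sum_eq_single 1]
  · change Finsupp.single t.tabloid _ t.tabloid = _
    simp
  · intro π hπ hne
    refine Finsupp.single_eq_of_ne fun hcon => hne ?_
    replace hcon : t.tabloid = t.tabloid.act π := hcon
    rw [mem_columnStabilizer] at hπ
    ext1 x
    refine t.ext_row_col ?_ (hπ x)
    have := congrArg (fun s => Tabloid.row s (π x)) hcon
    simpa [Tabloid.row_act] using this
  · intro h
    exact absurd (mem_columnStabilizer.2 fun _ => rfl) h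

theorem tabloidRep_polytabloid_of_column {t : Tableau n μ} {g : Perm (Fin n)}
    (hg : ∀ x, t.col (g x) = t.col x) :
    tabloidRep F n μ g (polytabloid F t) = ((Perm.sign g : ℤ) : F) • polytabloid F t := by
  unfold polytabloid
  rw [map_sum, Finset.smul_sum]
  refine Finset.sum_bij' (fun π _ => g * π) (fun π _ => g⁻¹ * π) ?_ ?_ ?_ ?_ ?_
  · intro π hπ
    rw [mem_columnStabilizer] at *
    intro x
    rw [Perm.mul_apply, hg, hπ]
  · intro π hπ
    rw [mem_columnStabilizer] at *
    intro x
    rw [Perm.mul_apply, ← hg (g⁻¹ _), perm_apply_inv, hπ]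
  · intro π _
    group
  · intro π _
    group
  · intro π _
    have h2 : ((Perm.sign g : ℤ) : F) * ((Perm.sign g : ℤ) : F) = 1 := by
      rw [← Int.cast_mul, ← Units.val_mul, Int.units_mul_self]; simp
    rw [Finsupp.smul_single, Perm.sign_mul, Units.val_mul, Int.cast_mul, smul_eq_mul, ← mul_assoc,
      h2, one_mul]
    exact Finsupp.mapDomain_single

theorem label_apply {T : Fin n → ℕ} {g : Perm (Fin n)} {z : Fin n}
    (hg : ∀ y, g y ≠ y → T y = T z) (y : Fin n) : T (g y) = T y := by
  by_cases h : g y = y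
  · rw [h]
  · rw [hg y h, hg (g y) fun h' => h (g.injective h')]

/-- The coefficient of the tabloid of `t` in `∏ (1 - g b)` applied to the polytabloid of `t`. -/
theorem noncommProd_polytabloid_apply {ι : Type*} (t : Tableau n μ) (T : Fin n → ℕ)
    (hT : ∀ x y, t.col x = t.col y → t.row x ≤ t.row y → T x ≤ T y)
    (g : ι → Perm (Fin n)) (z : ι → Fin n) (hTz : ∀ b b', T (z b) = T (z b') → b = b')
    (hg : ∀ b y, g b y ≠ y → T y = T (z b))
    (hcol : ∀ b y, T y = T (z b) → t.col y = t.col (z b) → y = z b)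
    (hrow : ∀ b, t.row (g b (z b)) ≠ t.row (z b)) (B : Finset ι)
    (comm : (B : Set ι).Pairwise (Function.onFun Commute fun b => 1 - tabloidRep F n μ (g b))) :
    B.noncommProd (fun b => 1 - tabloidRep F n μ (g b)) comm (polytabloid F t) t.tabloid = 1 := by
  classical
  have gT := fun b => label_apply (hg b)
  have gT' : ∀ b y, T ((g b)⁻¹ y) = T y := fun b y => by
    rw [← gT b ((g b)⁻¹ y), perm_apply_inv]
  -- The induction needs to know about the support: a tabloid there that is a label preserving
  -- translate of `{t}` differs from `(g b)⁻¹ {t}` on the letters with the label of `b`, for every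
  -- factor `b` not yet applied.
  suffices H : B.noncommProd (fun b => 1 - tabloidRep F n μ (g b)) comm (polytabloid F t)
        t.tabloid = 1 ∧
      ∀ s, B.noncommProd (fun b => 1 - tabloidRep F n μ (g b)) comm (polytabloid F t) s ≠ 0 →
        (∃ h : Perm (Fin n), (∀ x, T (h x) = T x) ∧ s = t.tabloid.act h) →
        ∀ b ∉ B, ∃ y, T y = T (z b) ∧ s.row y ≠ t.row (g b y) from H.1
  induction B using Finset.induction_on with
  | empty =>
    simp only [Finset.noncommProd_empty, Module.End.one_apply]
    refine ⟨polytabloid_apply_self t, fun s hs ⟨h, hh, hsh⟩ b _ => ?_⟩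
    obtain ⟨π, hπ, hsπ⟩ := exists_of_polytabloid_ne_zero hs
    have key := labels_invariant t T hT hπ hh fun x => by
      have := congrArg (fun s => Tabloid.row s x) (hsπ.symm.trans hsh)
      simpa [Tabloid.row_act] using this
    refine ⟨z b, rfl, fun hr => hrow b ?_⟩
    -- `π` preserves labels and columns, and `z b` is the only letter of its label in its column.
    have fix : π⁻¹ (z b) = z b := by
      refine hcol b _ ?_ ?_
      · rw [← key (π⁻¹ (z b)), perm_apply_inv]
      · rw [← hπ (π⁻¹ (z b)), perm_apply_inv]
    rw [← hr, hsπ, Tabloid.row_act, fix, Tableau.row_tabloid]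
  | insert b₀ B hb₀ ih =>
    obtain ⟨ih1, ih2⟩ := ih (comm.mono fun _ => Finset.mem_insert_of_mem)
    rw [Finset.noncommProd_insert_of_notMem _ _ _ _ hb₀]
    set w := B.noncommProd (fun b => 1 - tabloidRep F n μ (g b))
      (comm.mono fun _ => Finset.mem_insert_of_mem) (polytabloid F t) with hw
    have e : ∀ s, ((1 - tabloidRep F n μ (g b₀)) * B.noncommProd
        (fun b => 1 - tabloidRep F n μ (g b)) (comm.mono fun _ => Finset.mem_insert_of_mem))
        (polytabloid F t) s = w s - w (s.act (g b₀)⁻¹) := fun s => by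
      rw [Module.End.mul_apply, ← hw, LinearMap.sub_apply, Finsupp.sub_apply, tabloidRep_apply]
      rfl
    simp only [e]
    constructor
    · rw [ih1, sub_eq_self]
      by_contra hne
      obtain ⟨y, _, hy⟩ := ih2 _ hne ⟨_, gT' b₀, rfl⟩ b₀ hb₀
      exact hy (by rw [Tabloid.row_act, inv_inv, Tableau.row_tabloid])
    · intro s hs ⟨h, hh, hsh⟩ b hb
      rw [Finset.mem_insert, not_or] at hb
      by_cases h0 : w s = 0
      · rw [h0, zero_sub, neg_ne_zero] at hs
        obtain ⟨y, hy1, hy2⟩ := ih2 _ hs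
          ⟨(g b₀)⁻¹ * h, fun x => by rw [Perm.mul_apply, gT', hh], by
            rw [Tabloid.act_mul, hsh]⟩ b hb.2
        refine ⟨y, hy1, ?_⟩
        -- Distinct factors move letters of distinct labels, so applying `g b₀` does not disturb the
        -- rows of the letters belonging to `b`.
        have fix : g b₀ y = y := by
          by_contra hne
          exact hb.1 (hTz _ _ (hy1.symm.trans (hg b₀ y hne)))
        rwa [Tabloid.row_act, inv_inv, fix] at hy2
      · exact ih2 s h0 ⟨h, hh, hsh⟩ b hb.2

end Coefficients

/-! ### From fillings of the diagram to labelled tableaux -/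

section Filling

variable {n : ℕ} {μ : YoungDiagram}

theorem sum_colLen (μ : YoungDiagram) : ∑ j ∈ Finset.range (μ.rowLen 0), μ.colLen j = μ.card := by
  have h := Finset.card_eq_sum_card_fiberwise (s := μ.cells) (t := Finset.range (μ.rowLen 0))
    (f := Prod.snd) (fun c hc => by
      have hc' : (c.1, c.2) ∈ μ := hc
      simpa using YoungDiagram.mem_iff_lt_rowLen.1 (μ.up_left_mem (Nat.zero_le _) le_rfl hc'))
  rw [YoungDiagram.card, h]
  exact Finset.sum_congr rfl fun j _ => μ.colLen_eq_card

theorem Fillable.tableau {k r : ℕ} {Q : (Fin k → ℕ × ℕ) → Prop} (H : Fillable Q r μ.colLen)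
    (t : Tableau n μ) : ∃ (T : Fin n → ℕ) (x : Fin r × Fin k → Fin n), Function.Injective x ∧
      (∀ y y', t.col y = t.col y' → t.row y ≤ t.row y' → T y ≤ T y') ∧
      (∀ (a : Fin r) y, T y = a + 1 ↔ ∃ i, x (a, i) = y) ∧
      ∀ a, Q fun i => (t.row (x (a, i)), t.col (x (a, i))) := by
  obtain ⟨T, x, h1, h2, h3, h4, h5, h6⟩ := H
  have mem : ∀ c : ℕ × ℕ, c.1 < μ.colLen c.2 → c ∈ μ.cells := fun c hc =>
    YoungDiagram.mem_iff_lt_colLen.2 hc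
  have mem' : ∀ c : μ.cells, c.1.1 < μ.colLen c.1.2 := fun c =>
    YoungDiagram.mem_iff_lt_colLen.1 c.2
  have hx : ∀ (a : Fin r) y, T (t.symm y).1 = a + 1 ↔
      ∃ i, t ⟨x a i, mem _ (h3 a i)⟩ = y := by
    intro a y
    rw [h5 a _ (mem' _)]
    refine exists_congr fun i => ?_
    rw [← Equiv.eq_symm_apply, Subtype.ext_iff]
  refine ⟨fun y => T (t.symm y).1, fun p => t ⟨x p.1 p.2, mem _ (h3 p.1 p.2)⟩, ?_, ?_, hx, ?_⟩
  · rintro ⟨a, i⟩ ⟨b, j⟩ hij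
    have ha := (hx a _).2 ⟨i, rfl⟩
    have hb := (hx b _).2 ⟨j, rfl⟩
    have hab : a = b := by
      dsimp only at hij
      rw [hij] at ha
      exact Fin.ext (by omega)
    subst hab
    have := h4 a (by simpa using hij)
    rw [this]
  · intro y y' hc hr
    have := h1 (t.row y) (t.row y') (t.col y') hr (mem' (t.symm y'))
    rwa [← hc, show (t.row y, t.col y) = (t.symm y).1 from rfl, hc,
      show (t.row y', t.col y') = (t.symm y').1 from rfl] at this
  · intro a
    convert h6 a using 2 with i
    simp [Tableau.row, Tableau.col]

theorem fillable_pair_colLen (hμ : μ.card = n) {r : ℕ} (h1 : r ≤ level μ)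
    (h2 : r ≤ n / 2) : Fillable PairGood r μ.colLen := by
  have hs := sum_colLen μ
  have hc := Finset.card_filter_le (Finset.range (μ.rowLen 0)) fun j => μ.colLen j ≠ 0
  rw [Finset.card_range] at hc
  unfold level at h1
  by_cases hr : r = 0
  · subst hr; exact Fillable.zero _ _
  · exact fillable_pair (Finset.range (μ.rowLen 0)) r _ (by omega) (by omega)

/-- At most `λ₁` columns are nonempty and no column is higher than the first, so the two level
bounds become the last two conditions of `fillable_triple`. -/
theorem fillable_triple_colLen (hμ : μ.card = n) {r : ℕ} (h1 : r ≤ level μ)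
    (h2 : r ≤ level μ.transpose) (h3 : r ≤ n / 3) : Fillable TripleGood r μ.colLen := by
  have hs := sum_colLen μ
  have hc := Finset.card_filter_le (Finset.range (μ.rowLen 0)) fun j => μ.colLen j ≠ 0
  have ht : μ.transpose.card = μ.card := by simp [YoungDiagram.card, YoungDiagram.transpose]
  rw [Finset.card_range] at hc
  unfold level at h1 h2
  rw [ht, YoungDiagram.rowLen_transpose] at h2
  by_cases hr : r = 0
  · subst hr; exact Fillable.zero _ _
  · refine fillable_triple (Finset.range (μ.rowLen 0)) r _ (by omega) (Or.inr (by omega)) (Or.inr fun j _ => ?_)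
    have := μ.colLen_anti 0 j (Nat.zero_le _)
    omega

end Filling

/-! ### Disjoint transpositions and 3-cycles -/

section Cycles

/-- The cycle `i ↦ j ↦ k ↦ i`. -/
def cyc {α : Type*} [DecidableEq α] (i j k : α) : Perm α := swap i j * swap j k

variable {α : Type*} [DecidableEq α]

theorem comp_swap_apply {β : Type*} (f : α → β) {i j : α} (h : f i = f j) (y : α) :
    f (swap i j y) = f y := by
  rw [swap_apply_def]
  split_ifs with p q
  · rw [p, h]
  · rw [q, h]
  · rfl

theorem comp_cyc_apply {β : Type*} (f : α → β) {i j k : α} (h : f i = f j) (h' : f j = f k)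
    (y : α) : f (cyc i j k y) = f y := by
  rw [cyc, Perm.mul_apply, comp_swap_apply f h, comp_swap_apply f h']

theorem mem_of_swap_apply_ne {i j y : α} (h : swap i j y ≠ y) : y = i ∨ y = j := by
  by_contra hcon
  push Not at hcon
  exact h (swap_apply_of_ne_of_ne hcon.1 hcon.2)

theorem mem_of_cyc_apply_ne {i j k y : α} (h : cyc i j k y ≠ y) : y = i ∨ y = j ∨ y = k := by
  by_contra hcon
  push Not at hcon
  exact h (by rw [cyc, Perm.mul_apply, swap_apply_of_ne_of_ne hcon.2.1 hcon.2.2,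
    swap_apply_of_ne_of_ne hcon.1 hcon.2.1])

theorem cyc_apply_last {i j k : α} : cyc i j k k = i := by
  rw [cyc, Perm.mul_apply, swap_apply_right, swap_apply_right]

theorem cyc_apply_first {i j k : α} (hij : i ≠ j) (hik : i ≠ k) : cyc i j k i = j := by
  rw [cyc, Perm.mul_apply, swap_apply_of_ne_of_ne hij hik, swap_apply_left]

theorem cyc_apply_second {i j k : α} (hik : i ≠ k) (hjk : j ≠ k) : cyc i j k j = k := by
  rw [cyc, Perm.mul_apply, swap_apply_left, swap_apply_of_ne_of_ne hik.symm hjk.symm]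

theorem cyc_mul_cyc {i j k : α} (hij : i ≠ j) (hik : i ≠ k) (hjk : j ≠ k) :
    cyc i j k * cyc i j k = cyc i k j := by
  ext y
  rw [Perm.mul_apply]
  by_cases h : cyc i j k y = y
  · rw [h, h]
    by_contra hne
    rcases mem_of_cyc_apply_ne (Ne.symm hne) with rfl | rfl | rfl
    · exact hij (h.symm.trans (cyc_apply_first hij hik))
    · exact hik (cyc_apply_last.symm.trans h)
    · exact hjk (h.symm.trans (cyc_apply_second hik hjk))
  · rcases mem_of_cyc_apply_ne h with rfl | rfl | rfl
    · rw [cyc_apply_first hij hik, cyc_apply_second hik hjk, cyc_apply_first hik hij]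
    · rw [cyc_apply_second hik hjk, cyc_apply_last, cyc_apply_last]
    · rw [cyc_apply_last, cyc_apply_first hij hik, cyc_apply_second hij hjk.symm]

theorem cyc_reverse_mul_cyc {i j k : α} (hij : i ≠ j) (hik : i ≠ k) (hjk : j ≠ k) :
    cyc i k j * cyc i j k = 1 := by
  ext y
  rw [Perm.mul_apply, Perm.one_apply]
  by_cases h : cyc i j k y = y
  · rw [← cyc_mul_cyc hij hik hjk, Perm.mul_apply, h, h, h]
  · rcases mem_of_cyc_apply_ne h with rfl | rfl | rfl
    · rw [cyc_apply_first hij hik, cyc_apply_last]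
    · rw [cyc_apply_second hik hjk, cyc_apply_second hij hjk.symm]
    · rw [cyc_apply_last, cyc_apply_first hik hij]

theorem cyc_mul_cyc_mul_cyc {i j k : α} (hij : i ≠ j) (hik : i ≠ k) (hjk : j ≠ k) :
    cyc i j k * cyc i j k * cyc i j k = 1 := by
  rw [cyc_mul_cyc hij hik hjk, cyc_reverse_mul_cyc hij hik hjk]

theorem conj_cyc (g : Perm α) (i j k : α) : g * cyc i j k * g⁻¹ = cyc (g i) (g j) (g k) := by
  rw [cyc, cyc, Equiv.swap_apply_apply, Equiv.swap_apply_apply]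
  group

theorem commute_swap {s k : ℕ} {x : Fin s × Fin k → α} (hx : Function.Injective x) {a b : Fin s}
    (hab : a ≠ b) (i j i' j' : Fin k) :
    Commute (swap (x (a, i)) (x (a, j))) (swap (x (b, i')) (x (b, j'))) := by
  apply Perm.Disjoint.commute
  intro y
  by_contra hcon
  push Not at hcon
  rcases mem_of_swap_apply_ne hcon.1 with rfl | rfl <;>
    rcases mem_of_swap_apply_ne hcon.2 with h | h <;> simp [hx.eq_iff, hab] at h

/-- The `a`-th of the cycles given by the triples `x`. -/
def blockCyc {s : ℕ} (x : Fin s × Fin 3 → α) (a : Fin s) : Perm α :=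
  cyc (x (a, 0)) (x (a, 1)) (x (a, 2))

theorem eq_of_blockCyc_apply_ne {s : ℕ} {x : Fin s × Fin 3 → α} {a : Fin s} {y : α}
    (h : blockCyc x a y ≠ y) : ∃ i, x (a, i) = y := by
  rcases mem_of_cyc_apply_ne h with rfl | rfl | rfl <;> exact ⟨_, rfl⟩

theorem commute_blockCyc {s : ℕ} {x : Fin s × Fin 3 → α} (hx : Function.Injective x) {a b : Fin s}
    (hab : a ≠ b) : Commute (blockCyc x a) (blockCyc x b) := by
  apply Perm.Disjoint.commute
  intro y
  by_contra hcon
  push Not at hcon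
  obtain ⟨i, rfl⟩ := eq_of_blockCyc_apply_ne hcon.1
  obtain ⟨j, hj⟩ := eq_of_blockCyc_apply_ne hcon.2
  exact hab (Prod.ext_iff.1 (hx hj)).1.symm

theorem blockCyc_pow_three {s : ℕ} {x : Fin s × Fin 3 → α} (hx : Function.Injective x)
    (a : Fin s) : blockCyc x a * blockCyc x a * blockCyc x a = 1 :=
  cyc_mul_cyc_mul_cyc (hx.ne (by simp)) (hx.ne (by simp)) (hx.ne (by simp))

end Cycles

/-! ### The operator `1 + g + g²` for `g` of order dividing 3 -/

section CycSum

variable {F : Type*} [Field F] {G : Type*} [Group G] {V : Type*} [AddCommGroup V] [Module F V]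
  {ρ : Representation F G V}

/-- The sum over the powers of an element of order three. -/
def cycSum (ρ : Representation F G V) (g : G) : Module.End F V := 1 + ρ g + ρ g * ρ g

theorem cycSum_apply (g : G) (w : V) : cycSum ρ g w = w + ρ g w + ρ g (ρ g w) := rfl

theorem commute_cycSum_of_commute {X : Module.End F V} {g : G} (h : Commute X (ρ g)) :
    Commute X (cycSum ρ g) :=
  ((Commute.one_right _).add_right h).add_right (h.mul_right h)

theorem commute_cycSum {g h : G} (H : Commute g h) : Commute (cycSum ρ g) (cycSum ρ h) :=
  commute_cycSum_of_commute (commute_cycSum_of_commute (H.map ρ).symm).symm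

theorem cycSum_mul_one_sub {g : G} (hg : g * g * g = 1) : cycSum ρ g * (1 - ρ g) = 0 := by
  have : ρ g * ρ g * ρ g = 1 := by rw [← map_mul, ← map_mul, hg, map_one]
  rw [cycSum, mul_sub, mul_one, add_mul, add_mul, one_mul, this]
  abel

theorem cycSum_mul_self {g : G} (hg : g * g * g = 1) :
    cycSum ρ g * cycSum ρ g = (3 : F) • cycSum ρ g := by
  have h := cycSum_mul_one_sub (ρ := ρ) hg
  have h1 : cycSum ρ g * ρ g = cycSum ρ g := by
    rw [mul_sub, mul_one, sub_eq_zero] at h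
    exact h.symm
  change cycSum ρ g * (1 + ρ g + ρ g * ρ g) = _
  rw [mul_add, mul_add, ← mul_assoc, mul_one, h1, h1, show (3 : F) = 1 + 1 + 1 by norm_num, add_smul, add_smul, one_smul]

theorem cycSum_square {g : G} (hg : g * g * g = 1) : cycSum ρ (g * g) = cycSum ρ g := by
  have : g * g * (g * g) = g := by rw [← mul_assoc, hg, one_mul]
  rw [cycSum, ← map_mul, this, cycSum, map_mul]
  abel

theorem cycSum_conj (g h : G) (w : V) :
    cycSum ρ (g * h * g⁻¹) (ρ g w) = ρ g (cycSum ρ h w) := by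
  have e : ∀ v, ρ (g * h * g⁻¹) (ρ g v) = ρ g (ρ h v) := fun v => by
    rw [← Module.End.mul_apply, ← map_mul, inv_mul_cancel_right, map_mul, Module.End.mul_apply]
  simp only [cycSum_apply, map_add, e]

end CycSum

/-! ### Lower bounds: nonzero vectors in the Specht module -/

section LowerBounds

variable {F : Type u} [Field F] {n : ℕ} {μ : YoungDiagram}

theorem noncommProd_mem_specht {ι : Type*} (g : ι → Perm (Fin n)) (B : Finset ι)
    (comm : (B : Set ι).Pairwise (Function.onFun Commute fun b => 1 - tabloidRep F n μ (g b)))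
    (w : Tabloid n μ →₀ F) (hw : w ∈ (spechtSub F n μ).toSubmodule) :
    B.noncommProd (fun b => 1 - tabloidRep F n μ (g b)) comm w ∈
      (spechtSub F n μ).toSubmodule := by
  refine Finset.noncommProd_induction B _ comm
    (fun X => ∀ w ∈ (spechtSub F n μ).toSubmodule, X w ∈ (spechtSub F n μ).toSubmodule)
    (fun X Y hX hY w hw => hX _ (hY _ hw)) (fun w hw => hw) (fun b _ w hw => ?_) w hw
  exact Submodule.sub_mem _ hw ((spechtSub F n μ).apply_mem_toSubmodule _ hw)

theorem polytabloid_mem (t : Tableau n μ) :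
    polytabloid F t ∈ (spechtSub F n μ).toSubmodule :=
  Submodule.subset_span ⟨t, rfl⟩

theorem commute_one_sub {V : Type*} [AddCommGroup V] [Module F V] {X Y : Module.End F V}
    (h : Commute X Y) : Commute (1 - X) (1 - Y) :=
  ((Commute.one_left _).sub_left ((Commute.one_right _).sub_right h))

theorem commute_one_add_one_sub {V : Type*} [AddCommGroup V] [Module F V] {X Y : Module.End F V}
    (h : Commute X Y) : Commute (1 + X) (1 - Y) :=
  (Commute.one_left _).add_left ((Commute.one_right _).sub_right h)

theorem one_add_mul_one_sub {V : Type*} [AddCommGroup V] [Module F V] {X : Module.End F V}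
    (h : X * X = 1) : (1 + X) * (1 - X) = 0 := by
  rw [add_mul, one_mul, mul_sub, h, mul_one]
  abel

theorem exists_pair_eigenvector (hμ : μ.card = n) {r : ℕ} (h1 : r ≤ level μ) (h2 : r ≤ n / 2) :
    ∃ x : Fin r × Fin 2 → Fin n, Function.Injective x ∧
      ∃ w ∈ (spechtSub F n μ).toSubmodule, w ≠ 0 ∧
        ∀ a, tabloidRep F n μ (swap (x (a, 0)) (x (a, 1))) w = -w := by
  classical
  obtain ⟨t⟩ := exists_tableau hμ
  obtain ⟨T, x, hx, hT, hTx, hQ⟩ := (fillable_pair_colLen hμ h1 h2).tableau t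
  have fib : ∀ (a : Fin r) i, T (x (a, i)) = a + 1 := fun a i => (hTx a _).2 ⟨i, rfl⟩
  let τ : Fin r → Perm (Fin n) := fun a => swap (x (a, 0)) (x (a, 1))
  -- Only pairs in two different columns enter the product; a transposition inside a column already
  -- negates the polytabloid.
  let ι := {a : Fin r // t.col (x (a, 0)) ≠ t.col (x (a, 1))}
  have hτ : ∀ a b, Commute (tabloidRep F n μ (τ a)) (tabloidRep F n μ (τ b)) := fun a b => by
    by_cases hab : a = b
    · rw [hab]
    · exact (commute_swap hx hab 0 1 0 1).map _
  have comm : ((Finset.univ : Finset ι) : Set ι).Pairwise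
      (Function.onFun Commute fun b : ι => 1 - tabloidRep F n μ (τ b.1)) :=
    fun a _ b _ _ => show Commute (1 - tabloidRep F n μ (τ a.1)) (1 - tabloidRep F n μ (τ b.1)) from
      commute_one_sub (hτ _ _)
  have hcoef := noncommProd_polytabloid_apply (F := F) t T hT (fun b : ι => τ b.1)
    (fun b => x (b.1, 1))
    (fun b b' h => by
      rw [fib, fib] at h
      exact Subtype.ext (Fin.ext (by omega)))
    (fun b y hy => by
      rcases mem_of_swap_apply_ne hy with rfl | rfl <;> simp only [fib])
    (fun b y hy hc => by
      rw [fib, hTx] at hy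
      obtain ⟨i, rfl⟩ := hy
      fin_cases i
      · exact absurd hc b.2
      · rfl)
    (fun b => by
      simp only [τ, swap_apply_right]
      exact hQ b.1) Finset.univ comm
  refine ⟨x, hx, _, noncommProd_mem_specht _ Finset.univ comm _ (polytabloid_mem t), ?_, ?_⟩
  · intro h0
    rw [h0] at hcoef
    exact zero_ne_one hcoef
  · intro a
    rw [← add_eq_zero_iff_eq_neg, add_comm]
    set X := (Finset.univ : Finset ι).noncommProd (fun b : ι => 1 - tabloidRep F n μ (τ b.1)) comm
    change ((1 + tabloidRep F n μ (τ a)) * X) (polytabloid F t) = 0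
    by_cases ha : t.col (x (a, 0)) = t.col (x (a, 1))
    · have hc : Commute (1 + tabloidRep F n μ (τ a)) X :=
        Finset.noncommProd_commute _ _ _ _ fun b _ =>
          commute_one_add_one_sub (hτ a b.1)
      rw [hc.eq, Module.End.mul_apply]
      have : (1 + tabloidRep F n μ (τ a)) (polytabloid F t) = 0 := by
        rw [LinearMap.add_apply, Module.End.one_apply,
          tabloidRep_polytabloid_of_column (comp_swap_apply t.col ha),
          Perm.sign_swap (hx.ne (by simp))]
        simp
      rw [this, map_zero]
    · have hX : X = (1 - tabloidRep F n μ (τ a)) * _ :=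
        (Finset.mul_noncommProd_erase Finset.univ (Finset.mem_univ (⟨a, ha⟩ : ι)) _ comm).symm
      have h0 : (1 + tabloidRep F n μ (τ a)) * (1 - tabloidRep F n μ (τ a)) = 0 :=
        one_add_mul_one_sub (by rw [← map_mul, swap_mul_self, map_one])
      rw [hX, ← mul_assoc, h0, zero_mul, LinearMap.zero_apply]

/-- Each factor `1 - g` is annihilated by `1 + g + g²`. The third letter of a triple is the one
alone in its column, and the cycle sends it to the first, which lies in another row. -/
theorem exists_triple_vector (hμ : μ.card = n) {r : ℕ} (h1 : r ≤ level μ)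
    (h2 : r ≤ level μ.transpose) (h3 : r ≤ n / 3) :
    ∃ x : Fin r × Fin 3 → Fin n, Function.Injective x ∧
      ∃ w ∈ (spechtSub F n μ).toSubmodule, w ≠ 0 ∧
        ∀ a, cycSum (tabloidRep F n μ) (blockCyc x a) w = 0 := by
  classical
  obtain ⟨t⟩ := exists_tableau hμ
  obtain ⟨T, x, hx, hT, hTx, hQ⟩ := (fillable_triple_colLen hμ h1 h2 h3).tableau t
  have fib : ∀ (a : Fin r) i, T (x (a, i)) = a + 1 := fun a i => (hTx a _).2 ⟨i, rfl⟩
  have comm : ((Finset.univ : Finset (Fin r)) : Set (Fin r)).Pairwise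
      (Function.onFun Commute fun b => 1 - tabloidRep F n μ (blockCyc x b)) :=
    fun a _ b _ hab =>
      show Commute (1 - tabloidRep F n μ (blockCyc x a)) (1 - tabloidRep F n μ (blockCyc x b)) from
        commute_one_sub ((commute_blockCyc hx hab).map _)
  have hcoef := noncommProd_polytabloid_apply (F := F) t T hT (blockCyc x) (fun b => x (b, 2))
    (fun b b' h => by
      rw [fib, fib] at h
      exact Fin.ext (by omega))
    (fun b y hy => by
      obtain ⟨i, rfl⟩ := eq_of_blockCyc_apply_ne hy
      rw [fib, fib])
    (fun b y hy hc => by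
      rw [fib, hTx] at hy
      obtain ⟨i, rfl⟩ := hy
      fin_cases i
      · exact absurd hc (hQ b).1
      · exact absurd hc (hQ b).2.1
      · rfl)
    (fun b => by
      simp only [blockCyc, cyc_apply_last]
      exact (hQ b).2.2) Finset.univ comm
  refine ⟨x, hx, _, noncommProd_mem_specht _ Finset.univ comm _ (polytabloid_mem t), ?_, ?_⟩
  · intro h0
    rw [h0] at hcoef
    exact zero_ne_one hcoef
  · intro a
    rw [← Finset.mul_noncommProd_erase Finset.univ (Finset.mem_univ a) _ comm,
      ← Module.End.mul_apply, ← mul_assoc, cycSum_mul_one_sub (blockCyc_pow_three hx a), zero_mul,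
      LinearMap.zero_apply]

end LowerBounds

/-! ### Upper bounds by the level and by the conjugate level -/

section UpperBounds

variable {F : Type u} [Field F] {n : ℕ} {μ : YoungDiagram}

theorem le_card_of_forall_exists {s k : ℕ} {x : Fin s × Fin k → Fin n}
    (hx : Function.Injective x) (P : Fin n → Prop) [DecidablePred P]
    (h : ∀ a, ∃ i, P (x (a, i))) : s ≤ (Finset.univ.filter P).card := by
  choose i hi using h
  have := Finset.card_le_card_of_injOn (s := Finset.univ) (t := Finset.univ.filter P)
    (fun a => x (a, i a)) (fun a _ => by simpa using hi a)
    (fun a _ b _ hab => (Prod.ext_iff.1 (hx hab)).1)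
  simpa using this

theorem card_row_ne_zero (t : Tableau n μ) :
    (Finset.univ.filter fun y => t.row y ≠ 0).card = level μ := by
  have h1 : (Finset.univ.filter fun y => t.row y ≠ 0).card =
      (μ.cells.filter fun c => c.1 ≠ 0).card := by
    refine Finset.card_bij (fun y _ => (t.symm y).1) ?_ ?_ ?_
    · intro y hy
      exact Finset.mem_filter.2 ⟨(t.symm y).2, (Finset.mem_filter.1 hy).2⟩
    · intro y _ y' _ h
      exact t.symm.injective (Subtype.ext h)
    · intro c hc
      rw [Finset.mem_filter] at hc
      exact ⟨t ⟨c, hc.1⟩, Finset.mem_filter.2 ⟨Finset.mem_univ _, by simpa [Tableau.row] using! hc.2⟩,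
        by simp⟩
  have h2 : (μ.cells.filter fun c => c.1 = 0).card + (μ.cells.filter fun c => c.1 ≠ 0).card =
      μ.cells.card := Finset.card_filter_add_card_filter_not _
  rw [h1, level, YoungDiagram.rowLen_eq_card, YoungDiagram.row, YoungDiagram.card]
  omega

theorem card_col_ne_zero (t : Tableau n μ) :
    (Finset.univ.filter fun y => t.col y ≠ 0).card = level μ.transpose := by
  have h1 : (Finset.univ.filter fun y => t.col y ≠ 0).card =
      (μ.cells.filter fun c => c.2 ≠ 0).card := by
    refine Finset.card_bij (fun y _ => (t.symm y).1) ?_ ?_ ?_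
    · intro y hy
      exact Finset.mem_filter.2 ⟨(t.symm y).2, (Finset.mem_filter.1 hy).2⟩
    · intro y _ y' _ h
      exact t.symm.injective (Subtype.ext h)
    · intro c hc
      rw [Finset.mem_filter] at hc
      exact ⟨t ⟨c, hc.1⟩, Finset.mem_filter.2 ⟨Finset.mem_univ _, by simpa [Tableau.col] using! hc.2⟩,
        by simp⟩
  have h2 : (μ.cells.filter fun c => c.2 = 0).card + (μ.cells.filter fun c => c.2 ≠ 0).card =
      μ.cells.card := Finset.card_filter_add_card_filter_not _
  have h3 : μ.transpose.card = μ.cells.card := by simp [YoungDiagram.card, YoungDiagram.transpose]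
  rw [h1, level, YoungDiagram.rowLen_transpose, YoungDiagram.colLen_eq_card, YoungDiagram.col, h3]
  omega

theorem Tabloid.exists_row_ne_zero_le {s k : ℕ} {x : Fin s × Fin k → Fin n}
    (hx : Function.Injective x) (S : Tabloid n μ) (h : ∀ a, ∃ i, S.row (x (a, i)) ≠ 0) :
    s ≤ level μ := by
  induction S using Quotient.inductionOn with
  | h t =>
    rw [← card_row_ne_zero t]
    exact le_card_of_forall_exists hx _ h

/-- A tabloid with both letters of a pair in its first row is fixed by the transposition, so its
coefficient equals its own negative. The pairs being disjoint, they use distinct letters outside the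
first row. -/
theorem pair_le_level (h2 : (2 : F) ≠ 0) {s : ℕ} {x : Fin s × Fin 2 → Fin n}
    (hx : Function.Injective x) {w : Tabloid n μ →₀ F} (hw : w ≠ 0)
    (h : ∀ a, tabloidRep F n μ (swap (x (a, 0)) (x (a, 1))) w = -w) : s ≤ level μ := by
  obtain ⟨S, hS⟩ := Finsupp.ne_iff.1 hw
  refine S.exists_row_ne_zero_le hx fun a => ?_
  by_contra hcon
  push Not at hcon
  have h1 := DFunLike.congr_fun (h a) S
  have fix : S.act (swap (x (a, 0)) (x (a, 1)))⁻¹ = S :=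
    Tabloid.ext_row fun y => by
      rw [Tabloid.row_act, inv_inv, comp_swap_apply S.row (by rw [hcon, hcon])]
  rw [tabloidRep_apply, fix, Finsupp.neg_apply, eq_neg_iff_add_eq_zero, ← two_mul] at h1
  exact (mul_ne_zero h2 hS) h1

theorem triple_le_level (h3 : (3 : F) ≠ 0) {s : ℕ} {x : Fin s × Fin 3 → Fin n}
    (hx : Function.Injective x) {w : Tabloid n μ →₀ F} (hw : w ≠ 0)
    (h : ∀ a, cycSum (tabloidRep F n μ) (blockCyc x a) w = 0) : s ≤ level μ := by
  obtain ⟨S, hS⟩ := Finsupp.ne_iff.1 hw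
  refine S.exists_row_ne_zero_le hx fun a => ?_
  by_contra hcon
  push Not at hcon
  have h1 := DFunLike.congr_fun (h a) S
  have fix : S.act (blockCyc x a)⁻¹ = S :=
    Tabloid.ext_row fun y => by
      rw [Tabloid.row_act, inv_inv, blockCyc,
        comp_cyc_apply S.row (by rw [hcon, hcon]) (by rw [hcon, hcon])]
  rw [cycSum_apply, Finsupp.add_apply, Finsupp.add_apply, tabloidRep_apply, tabloidRep_apply,
    tabloidRep_apply, fix, fix, Finsupp.zero_apply] at h1
  refine mul_ne_zero h3 hS ?_
  rw [← h1]
  ring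

/-- The projections `1 - N/3` along the triples fix `w`. With too many triples, every tableau has
one entirely in its first column; its cycle is even and fixes the polytabloid, which the projection
then kills. Membership in the span of the polytabloids is essential here. -/
theorem triple_le_level_transpose (h3 : (3 : F) ≠ 0) {s : ℕ} {x : Fin s × Fin 3 → Fin n}
    (hx : Function.Injective x) {w : Tabloid n μ →₀ F} (hw : w ≠ 0)
    (hwS : w ∈ (spechtSub F n μ).toSubmodule)
    (h : ∀ a, cycSum (tabloidRep F n μ) (blockCyc x a) w = 0) : s ≤ level μ.transpose := by
  by_contra hlt
  let Q : Fin s → Module.End F (Tabloid n μ →₀ F) :=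
    fun a => 1 - (3 : F)⁻¹ • cycSum (tabloidRep F n μ) (blockCyc x a)
  have comm : ((Finset.univ : Finset (Fin s)) : Set (Fin s)).Pairwise
      (Function.onFun Commute Q) := fun a _ b _ hab =>
    commute_one_sub (((commute_cycSum (commute_blockCyc hx hab)).smul_left _).smul_right _)
  have h1 : Finset.univ.noncommProd Q comm w = w := by
    refine Finset.noncommProd_induction Finset.univ Q comm (fun X => X w = w)
      (fun X Y hX hY => by rw [Module.End.mul_apply, hY, hX]) rfl fun a _ => ?_
    simp only [Q, LinearMap.sub_apply, LinearMap.smul_apply, h a, smul_zero, sub_zero,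
      Module.End.one_apply]
  have h2 : Finset.univ.noncommProd Q comm w = 0 := by
    have hwS' : w ∈ Submodule.span F (Set.range fun t : Tableau n μ => polytabloid F t) := hwS
    rw [← LinearMap.mem_ker]
    refine Submodule.span_le.2 ?_ hwS'
    rintro _ ⟨t, rfl⟩
    change Finset.univ.noncommProd Q comm (polytabloid F t) = 0
    obtain ⟨a, ha⟩ : ∃ a, ∀ i, t.col (x (a, i)) = 0 := by
      by_contra hcon
      push Not at hcon
      have := le_card_of_forall_exists hx (fun y => t.col y ≠ 0) hcon
      rw [card_col_ne_zero t] at this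
      exact hlt this
    rw [← Finset.noncommProd_erase_mul Finset.univ (Finset.mem_univ a) Q comm,
      Module.End.mul_apply]
    have fix : tabloidRep F n μ (blockCyc x a) (polytabloid F t) = polytabloid F t := by
      have hc : ∀ y, t.col (blockCyc x a y) = t.col y :=
        comp_cyc_apply t.col ((ha 0).trans (ha 1).symm) ((ha 1).trans (ha 2).symm)
      rw [tabloidRep_polytabloid_of_column hc, blockCyc, cyc, Perm.sign_mul,
        Perm.sign_swap (hx.ne (by simp)), Perm.sign_swap (hx.ne (by simp))]
      simp
    have : Q a (polytabloid F t) = 0 := by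
      simp only [Q, LinearMap.sub_apply, LinearMap.smul_apply, cycSum_apply, fix,
        Module.End.one_apply]
      rw [show polytabloid F t + polytabloid F t + polytabloid F t = (3 : F) • polytabloid F t by
        rw [show (3 : F) = 1 + 1 + 1 by norm_num, add_smul, add_smul, one_smul],
        inv_smul_smul₀ h3, sub_self]
    rw [this, map_zero]
  exact hw (h1.symm.trans h2)

theorem le_div_of_injective {s k : ℕ} (hk : 0 < k) {x : Fin s × Fin k → Fin n}
    (hx : Function.Injective x) : s ≤ n / k := by
  have := Fintype.card_le_of_injective x hx
  rw [Nat.le_div_iff_mul_le hk]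
  simpa using this

end UpperBounds

/-! ### The 2-rank, and the 3-rank at a cube root of unity -/

section Ranks

variable {F : Type u} [Field F] {n : ℕ} {μ : YoungDiagram}

theorem isTwoRank_specht (h2 : (2 : F) ≠ 0) (hμ : μ.card = n) :
    IsTwoRank (V := SpechtModule F n μ) (specht F n μ) (min (level μ) (n / 2)) := by
  constructor
  · obtain ⟨x, hx, w, hw, hw0, h⟩ :=
      exists_pair_eigenvector (F := F) hμ (min_le_left _ _) (min_le_right (level μ) (n / 2))
    exact ⟨x, hx, ⟨w, hw⟩, fun h0 => hw0 (congrArg Subtype.val h0), fun a => Subtype.ext (h a)⟩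
  · rintro s ⟨x, hx, w, hw0, h⟩
    exact le_min (pair_le_level h2 hx (fun h0 => hw0 (Subtype.ext h0))
      fun a => congrArg Subtype.val (h a)) (le_div_of_injective (by omega) hx)

theorem triple_le_min (h3 : (3 : F) ≠ 0) {s : ℕ} {x : Fin s × Fin 3 → Fin n}
    (hx : Function.Injective x) {w : SpechtModule F n μ} (hw : w ≠ 0)
    (h : ∀ a, cycSum (specht F n μ) (blockCyc x a) w = 0) :
    s ≤ min (min (level μ) (level μ.transpose)) (n / 3) := by
  have h' := fun a => congrArg Subtype.val (h a)
  have hw' : (w : Tabloid n μ →₀ F) ≠ 0 := fun h0 => hw (Subtype.ext h0)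
  exact le_min (le_min (triple_le_level h3 hx hw' h') (triple_le_level_transpose h3 hx hw' w.2 h'))
    (le_div_of_injective (by omega) hx)

theorem exists_triple_min (hμ : μ.card = n) :
    ∃ x : Fin (min (min (level μ) (level μ.transpose)) (n / 3)) × Fin 3 → Fin n,
      Function.Injective x ∧ ∃ w : SpechtModule F n μ, w ≠ 0 ∧
        ∀ a, cycSum (specht F n μ) (blockCyc x a) w = 0 := by
  obtain ⟨x, hx, w, hw, hw0, h⟩ := exists_triple_vector (F := F) hμ
    ((min_le_left _ _).trans (min_le_left _ _)) ((min_le_left _ _).trans (min_le_right _ _))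
    (min_le_right (min (level μ) (level μ.transpose)) (n / 3))
  exact ⟨x, hx, ⟨w, hw⟩, fun h0 => hw0 (congrArg Subtype.val h0), fun a => Subtype.ext (h a)⟩

theorem cycSum_eq_zero_of_eigenvector {G V : Type*} [Group G] [AddCommGroup V] [Module F V]
    {ρ : Representation F G V} {ζ : F} (hζ : 1 + ζ + ζ * ζ = 0) {g : G} {w : V}
    (h : ρ g w = ζ • w) : cycSum ρ g w = 0 := by
  rw [cycSum_apply, h, map_smul, h, smul_smul, ← one_smul F w, smul_smul, smul_smul, ← add_smul,
    ← add_smul, mul_one, mul_one, hζ, zero_smul]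

/-- A vector killed by the sums over commuting elements of order three can be changed into a
simultaneous eigenvector. -/
theorem exists_eigenvector_of_cycSum_eq_zero {G V ι : Type*} [Group G] [AddCommGroup V]
    [Module F V] {ρ : Representation F G V} {ζ : F} (hζ : 1 + ζ + ζ * ζ = 0) (c : ι → G)
    (hc : ∀ a b, Commute (c a) (c b)) {w : V} (hw : w ≠ 0) (h : ∀ a, cycSum ρ (c a) w = 0)
    (A : Finset ι) :
    ∃ w : V, w ≠ 0 ∧ (∀ a, cycSum ρ (c a) w = 0) ∧
      ∀ a ∈ A, ρ (c a) w = ζ • w ∨ ρ (c a) w = (ζ * ζ) • w := by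
  classical
  induction A using Finset.induction_on with
  | empty => exact ⟨w, hw, h, by simp⟩
  | insert b A hb ih =>
    obtain ⟨w, hw, h, hA⟩ := ih
    have comm : ∀ a v, ρ (c a) (ρ (c b) v) = ρ (c b) (ρ (c a) v) := fun a v =>
      LinearMap.congr_fun ((hc a b).map ρ).eq v
    -- By `1 + X + X² = (X - ζ)(X - ζ²)`, the vector `(c b - ζ²) w` is a `ζ`-eigenvector unless it
    -- is zero, and then `w` is a `ζ²`-eigenvector. Commutation preserves all earlier relations.
    by_cases h0 : ρ (c b) w - (ζ * ζ) • w = 0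
    · refine ⟨w, hw, h, fun a ha => ?_⟩
      rcases Finset.mem_insert.1 ha with rfl | ha
      · exact Or.inr (sub_eq_zero.1 h0)
      · exact hA a ha
    · refine ⟨_, h0, fun a => ?_, fun a ha => ?_⟩
      · have : cycSum ρ (c a) (ρ (c b) w) = ρ (c b) (cycSum ρ (c a) w) := by
          simp only [cycSum_apply, map_add, comm]
        rw [map_sub, map_smul, this, h, map_zero, smul_zero, sub_zero]
      · rcases Finset.mem_insert.1 ha with rfl | ha
        · left
          have h1 := h a
          rw [cycSum_apply, add_eq_zero_iff_eq_neg'] at h1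
          have e1 : ζ * (ζ * ζ) = 1 := by linear_combination (ζ - 1) * hζ
          have e2 : ζ * ζ = -1 - ζ := by linear_combination hζ
          rw [map_sub, map_smul, h1, smul_sub, smul_smul, e1, one_smul, e2, sub_smul, neg_smul,
            one_smul]
          abel
        · rcases hA a ha with h1 | h1
          · left
            rw [map_sub, map_smul, comm, h1, map_smul, smul_sub, smul_comm ζ]
          · right
            rw [map_sub, map_smul, comm, h1, map_smul, smul_sub]

theorem isThreeRankAt_specht (h3 : (3 : F) ≠ 0) {ζ : F} (hζ : IsPrimitiveRoot ζ 3)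
    (hμ : μ.card = n) :
    IsThreeRankAt (V := SpechtModule F n μ) ζ (specht F n μ)
      (min (min (level μ) (level μ.transpose)) (n / 3)) := by
  have hz : 1 + ζ + ζ * ζ = 0 := by
    have := hζ.geom_sum_eq_zero (by norm_num)
    simp only [Finset.sum_range_succ, Finset.sum_range_zero, zero_add, pow_zero, pow_one] at this
    rw [← pow_two]; exact this
  constructor
  · obtain ⟨x, hx, w, hw, h⟩ := exists_triple_min (F := F) hμ
    obtain ⟨w, hw, -, h⟩ := exists_eigenvector_of_cycSum_eq_zero hz (blockCyc x)
      (fun a b => by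
        by_cases hab : a = b
        · subst hab
          exact Commute.refl _
        · exact commute_blockCyc hx hab) hw h Finset.univ
    classical
    -- Exchanging the last two letters of a triple inverts its cycle and turns the eigenvalue `ζ²`
    -- into `ζ`.
    let e := fun a => if specht F n μ (blockCyc x a) w = ζ • w then (1 : Perm (Fin 3)) else swap 1 2
    refine ⟨fun p => x (p.1, e p.1 p.2), ?_, w, hw, fun a => ?_⟩
    · rintro ⟨a, i⟩ ⟨b, j⟩ hij
      have h1 := Prod.ext_iff.1 (hx hij)
      have hab : a = b := h1.1
      subst hab
      exact Prod.ext rfl ((e a).injective h1.2)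
    · by_cases ha : specht F n μ (blockCyc x a) w = ζ • w
      · have he : e a = 1 := if_pos ha
        simp only [he, Perm.one_apply]
        exact ha
      · have h1 := (h a (Finset.mem_univ a)).resolve_left ha
        simp only [e, ha, if_false]
        rw [swap_apply_left, swap_apply_right, swap_apply_of_ne_of_ne (by decide) (by decide)]
        have hinv : cyc (x (a, 0)) (x (a, 2)) (x (a, 1)) * cyc (x (a, 0)) (x (a, 1)) (x (a, 2)) = 1 :=
          cyc_reverse_mul_cyc (hx.ne (by simp)) (hx.ne (by simp)) (hx.ne (by simp))
        have h2 := LinearMap.congr_fun (congrArg (specht F n μ) hinv) w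
        rw [map_mul, map_one, Module.End.mul_apply, ← blockCyc, h1, map_smul, Module.End.one_apply] at h2
        have e1 : ζ * (ζ * ζ) = 1 := by linear_combination (ζ - 1) * hz
        have h3 := congrArg (fun v => ζ • v) h2
        simp only [smul_smul, e1, one_smul] at h3
        exact h3
  · rintro s ⟨x, hx, w, hw, h⟩
    exact triple_le_min h3 hx hw fun a => cycSum_eq_zero_of_eigenvector hz (h a)

end Ranks

/-! ### The module `S^(2,1)` of the symmetric group on three letters -/

section Standard

variable {F : Type u} [Field F]

theorem sum_sign_columnStabilizer {n : ℕ} {μ : YoungDiagram} (t : Tableau n μ) {i j : Fin n}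
    (hij : i ≠ j) (hc : t.col i = t.col j) :
    ∑ π ∈ columnStabilizer t, ((Perm.sign π : ℤ) : F) = 0 := by
  refine Finset.sum_involution (fun π _ => swap i j * π) ?_ ?_ ?_ ?_
  · intro π _
    simp [Perm.sign_swap hij]
  · intro π _ _ h
    exact hij (Equiv.swap_eq_one_iff.1 (mul_eq_right.1 h))
  · intro π hπ
    rw [mem_columnStabilizer] at *
    intro x
    rw [Perm.mul_apply, comp_swap_apply t.col hc, hπ]
  · intro π _
    rw [← mul_assoc, swap_mul_self, one_mul]

theorem mem_shape21 (c : ℕ × ℕ) : c ∈ shape21 ↔ c = (0, 0) ∨ c = (0, 1) ∨ c = (1, 0) := by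
  obtain ⟨i, j⟩ := c
  rw [shape21, YoungDiagram.mem_ofRowLens]
  constructor
  · rintro ⟨h, h'⟩
    simp only [List.length_cons, List.length_nil] at h
    interval_cases i <;> simp at h' ⊢ <;> omega
  · rintro (h | h | h) <;> simp only [Prod.mk.injEq] at h <;> obtain ⟨rfl, rfl⟩ := h <;> simp

theorem card_shape21 : shape21.card = 3 := rfl

theorem rowLen_shape21 : shape21.rowLen 0 = 2 := by
  refine le_antisymm ?_ ?_
  · by_contra h
    have := YoungDiagram.mem_iff_lt_rowLen.2 (not_le.1 h)
    simp [mem_shape21] at this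
  · exact YoungDiagram.mem_iff_lt_rowLen.1 (by simp [mem_shape21])

theorem colLen_shape21 : shape21.colLen 0 = 2 := by
  refine le_antisymm ?_ ?_
  · by_contra h
    have := YoungDiagram.mem_iff_lt_colLen.2 (not_le.1 h)
    simp [mem_shape21] at this
  · exact YoungDiagram.mem_iff_lt_colLen.1 (by simp [mem_shape21])

/-- The cell of the diagram `(2,1)` in the second row. -/
def bottomCell : shape21.cells := ⟨(1, 0), (mem_shape21 _).2 (by simp)⟩

theorem row_eq_one_iff (t : Tableau 3 shape21) (x : Fin 3) :
    t.row x = 1 ↔ x = t bottomCell := by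
  have hx := (mem_shape21 _).1 ((YoungDiagram.mem_cells _).1 (t.symm x).2)
  rw [← Equiv.symm_apply_eq, Subtype.ext_iff]
  rcases hx with h | h | h <;> simp [Tableau.row, h, bottomCell]

theorem row_le_one (t : Tableau 3 shape21) (x : Fin 3) : t.row x ≤ 1 := by
  have hx := (mem_shape21 _).1 ((YoungDiagram.mem_cells _).1 (t.symm x).2)
  rcases hx with h | h | h <;> simp [Tableau.row, h]

/-- The letter in the second row of a tabloid of shape `(2,1)`. -/
def bottomLetter (s : Tabloid 3 shape21) : Fin 3 :=
  Quotient.lift (s := tableauSetoid 3 shape21) (fun t : Tableau 3 shape21 => t bottomCell)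
    (fun a b h => by
      rw [← row_eq_one_iff b, ← h, row_eq_one_iff a]) s

theorem bottomLetter_act (g : Perm (Fin 3)) (s : Tabloid 3 shape21) :
    bottomLetter (s.act g) = g (bottomLetter s) := by
  induction s using Quotient.inductionOn
  rfl

theorem bottomLetter_injective : Function.Injective bottomLetter := by
  intro s s' h
  induction s using Quotient.inductionOn with
  | h t =>
  induction s' using Quotient.inductionOn with
  | h t' =>
  refine Quotient.sound (s := tableauSetoid 3 shape21) fun x => ?_
  have h1 := row_eq_one_iff t x
  have h2 := row_eq_one_iff t' x
  rw [show t bottomCell = t' bottomCell from h, ← h2] at h1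
  have := row_le_one t x
  have := row_le_one t' x
  omega

theorem exists_column_pair (t : Tableau 3 shape21) :
    ∃ i j : Fin 3, i ≠ j ∧ t.col i = t.col j := by
  refine ⟨t ⟨(0, 0), (mem_shape21 _).2 (by simp)⟩, t bottomCell, ?_, ?_⟩
  · rw [Ne, t.injective.eq_iff, bottomCell, Subtype.mk.injEq]
    simp
  · simp [Tableau.col, bottomCell]

theorem sum_coeff_specht21 (w : SpechtModule F 3 shape21) :
    Finsupp.linearCombination F (fun _ : Tabloid 3 shape21 => (1 : F)) w.1 = 0 := by
  have hw : w.1 ∈ Submodule.span F (Set.range fun t : Tableau 3 shape21 => polytabloid F t) := w.2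
  rw [← LinearMap.mem_ker]
  refine Submodule.span_le.2 ?_ hw
  rintro _ ⟨t, rfl⟩
  change Finsupp.linearCombination F (fun _ : Tabloid 3 shape21 => (1 : F)) (polytabloid F t) = 0
  obtain ⟨i, j, hij, hc⟩ := exists_column_pair t
  unfold polytabloid
  rw [map_sum, ← sum_sign_columnStabilizer (F := F) t hij hc]
  refine Finset.sum_congr rfl fun π _ => ?_
  rw [Finsupp.linearCombination_single, smul_eq_mul, mul_one]

variable {L : Type v} [AddCommGroup L] [Module F L] {τ : Representation F (Perm (Fin 3)) L}

theorem cyc_perm_three : ∀ i j k : Fin 3, i ≠ j → i ≠ k → j ≠ k →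
    cyc i j k = cyc 0 1 2 ∨ cyc i j k = cyc 0 1 2 * cyc 0 1 2 := by
  decide

/-- If every `v + (0 1) v` vanished, all transpositions would act as `-1`, the 3-cycle as `1`, and
its sum as `3 ≠ 0`. A nonzero such vector is fixed by the stabilizer of the letter 2, so its
translates are indexed by letters; they add up to zero by `hN`. -/
theorem exists_natural_family [Nontrivial L] (h3 : (3 : F) ≠ 0)
    (hN : cycSum τ (cyc 0 1 2) = 0) :
    ∃ u : Fin 3 → L, (∀ g i, τ g (u i) = u (g i)) ∧ u 0 + u 1 + u 2 = 0 ∧ ∃ i, u i ≠ 0 := by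
  obtain ⟨v, hv⟩ : ∃ v, v + τ (swap 0 1) v ≠ 0 := by
    by_contra hcon
    push Not at hcon
    have h01 : ∀ v, τ (swap 0 1) v = -v := fun v => (neg_eq_of_add_eq_zero_right (hcon v)).symm
    have h12 : ∀ v, τ (swap 1 2) v = -v := fun v => by
      have : (swap 1 2 : Perm (Fin 3)) = cyc 0 1 2 * swap 0 1 * (cyc 0 1 2)⁻¹ := by decide
      rw [this, map_mul, map_mul, Module.End.mul_apply, Module.End.mul_apply, h01, map_neg,
        ← Module.End.mul_apply, ← map_mul, mul_inv_cancel, map_one, Module.End.one_apply]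
    have hc : ∀ v, τ (cyc 0 1 2) v = v := fun v => by
      rw [cyc, map_mul, Module.End.mul_apply, h12, h01, neg_neg]
    obtain ⟨v, hv⟩ := exists_ne (0 : L)
    have h := LinearMap.congr_fun hN v
    rw [cycSum_apply, hc, hc, LinearMap.zero_apply] at h
    refine smul_ne_zero h3 hv ?_
    rw [show (3 : F) = 1 + 1 + 1 by norm_num, add_smul, add_smul, one_smul, h]
  set U := v + τ (swap 0 1) v with hU
  have fix : τ (swap 0 1) U = U := by
    rw [hU, map_add, ← Module.End.mul_apply, ← map_mul, swap_mul_self, map_one,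
      Module.End.one_apply, add_comm]
  have equi : ∀ g i, τ g (τ (swap 2 i) U) = τ (swap 2 (g i)) U := fun g i => by
    have key : ∀ (g : Perm (Fin 3)) (i : Fin 3), g * swap 2 i = swap 2 (g i) ∨
        g * swap 2 i = swap 2 (g i) * swap 0 1 := by decide
    rw [← Module.End.mul_apply, ← map_mul]
    rcases key g i with h | h
    · rw [h]
    · rw [h, map_mul, Module.End.mul_apply, fix]
  refine ⟨fun i => τ (swap 2 i) U, equi, ?_, 2, ?_⟩
  · have h := LinearMap.congr_fun hN (τ (swap 2 2) U)
    rw [cycSum_apply, equi, equi, LinearMap.zero_apply, show cyc (0 : Fin 3) 1 2 2 = 0 by decide,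
      show cyc (0 : Fin 3) 1 2 0 = 1 by decide] at h
    rw [← h]
    abel
  · change τ (swap 2 2) U ≠ 0
    rw [swap_self, ← Perm.one_def, map_one]
    exact hv

/-- The `u i` are distinct, since otherwise all would coincide and `3 • u 1 = 0`. Subtracting from a
relation its image under a transposition gives `(W i - W j) • (u i - u j) = 0`, so `W` is constant,
and zero because its sum is. -/
theorem linearIndependent_of_natural (h3 : (3 : F) ≠ 0) {u : Fin 3 → L}
    (hu : ∀ g i, τ g (u i) = u (g i)) (h0 : u 0 + u 1 + u 2 = 0) (hne : ∃ i, u i ≠ 0)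
    {W : Fin 3 → F} (hW : W 0 + W 1 + W 2 = 0) (hWu : W 0 • u 0 + W 1 • u 1 + W 2 • u 2 = 0) :
    W = 0 := by
  have hne01 : u 0 ≠ u 1 := by
    intro h
    have h2 : u 2 = u 1 := by
      have := congrArg (τ (swap 0 2)) h
      rwa [hu, hu, swap_apply_left, swap_apply_of_ne_of_ne (by decide) (by decide)] at this
    have h1 : u 1 = 0 := by
      rw [h, h2] at h0
      refine (smul_eq_zero.1 ?_).resolve_left h3
      rw [← h0, show (3 : F) = 1 + 1 + 1 by norm_num, add_smul, add_smul, one_smul]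
    obtain ⟨i, hi⟩ := hne
    fin_cases i
    · exact hi (h.trans h1)
    · exact hi h1
    · exact hi (h2.trans h1)
  have hne12 : u 1 ≠ u 2 := by
    intro h
    apply hne01
    have := congrArg (τ (cyc 0 1 2 * cyc 0 1 2)) h
    rwa [hu, hu, show (cyc 0 1 2 * cyc 0 1 2 : Perm (Fin 3)) 1 = 0 by decide,
      show (cyc 0 1 2 * cyc 0 1 2 : Perm (Fin 3)) 2 = 1 by decide] at this
  have e01 : (W 0 - W 1) • (u 0 - u 1) = 0 := by
    have h := congrArg (τ (swap 0 1)) hWu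
    simp only [map_add, map_smul, hu, map_zero, swap_apply_left, swap_apply_right] at h
    rw [swap_apply_of_ne_of_ne (by decide) (by decide)] at h
    calc (W 0 - W 1) • (u 0 - u 1) = (W 0 • u 0 + W 1 • u 1 + W 2 • u 2) -
        (W 0 • u 1 + W 1 • u 0 + W 2 • u 2) := by module
      _ = 0 := by rw [hWu, h, sub_zero]
  have e12 : (W 1 - W 2) • (u 1 - u 2) = 0 := by
    have h := congrArg (τ (swap 1 2)) hWu
    simp only [map_add, map_smul, hu, map_zero, swap_apply_left, swap_apply_right] at h
    rw [swap_apply_of_ne_of_ne (by decide) (by decide)] at h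
    calc (W 1 - W 2) • (u 1 - u 2) = (W 0 • u 0 + W 1 • u 1 + W 2 • u 2) -
        (W 0 • u 0 + W 1 • u 2 + W 2 • u 1) := by module
      _ = 0 := by rw [hWu, h, sub_zero]
  have w01 := sub_eq_zero.1 ((smul_eq_zero.1 e01).resolve_right (sub_ne_zero.2 hne01))
  have w12 := sub_eq_zero.1 ((smul_eq_zero.1 e12).resolve_right (sub_ne_zero.2 hne12))
  have w1 : W 1 = 0 := by
    refine (mul_eq_zero.1 ?_).resolve_left h3
    rw [w01, ← w12] at hW
    rw [← hW]
    ring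
  funext i
  fin_cases i
  · exact w01.trans w1
  · exact w1
  · exact w12.symm.trans w1

/-- A nonzero representation of `S₃` without invariants of the cycle of order three contains
`S^(2,1)`. -/
theorem exists_embedding_specht21 [Nontrivial L] (h3 : (3 : F) ≠ 0)
    (hN : cycSum τ (cyc 0 1 2) = 0) :
    ∃ f : Representation.IntertwiningMap (specht F 3 shape21) τ, Function.Injective f := by
  obtain ⟨u, hu, h0, hne⟩ := exists_natural_family h3 hN
  -- A tabloid of shape `(2,1)` is determined by its bottom letter. The elements of `S^(2,1)` have
  -- coefficient sum zero, which is what injectivity of the restriction of `Φ` requires.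
  let Φ : (Tabloid 3 shape21 →₀ F) →ₗ[F] L :=
    Finsupp.linearCombination F fun s => u (bottomLetter s)
  have hΦ : ∀ g w, Φ (tabloidRep F 3 shape21 g w) = τ g (Φ w) := by
    intro g w
    induction w using Finsupp.induction_linear with
    | zero => simp
    | add w w' h h' => simp only [map_add, h, h']
    | single s a =>
      have : tabloidRep F 3 shape21 g (Finsupp.single s a) = Finsupp.single (s.act g) a :=
        Finsupp.mapDomain_single
      simp only [this, Φ, Finsupp.linearCombination_single, bottomLetter_act, map_smul, hu]
  let f : SpechtModule F 3 shape21 →ₗ[F] L :=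
    Φ ∘ₗ (spechtSub F 3 shape21).toSubmodule.subtype
  refine ⟨f.intertwiningMap_of_isIntertwiningMap _ _ fun g w => hΦ g w.1, ?_⟩
  change Function.Injective f
  rw [injective_iff_map_eq_zero]
  intro w hw
  set W := Finsupp.mapDomain bottomLetter w.1 with hWdef
  have e1 : Finsupp.linearCombination F u W = 0 := by
    rw [hWdef, Finsupp.linearCombination_mapDomain]
    exact hw
  have e2 : Finsupp.linearCombination F (fun _ => (1 : F)) W = 0 := by
    rw [hWdef, Finsupp.linearCombination_mapDomain]
    exact sum_coeff_specht21 w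
  rw [Finsupp.linearCombination_apply, Finsupp.sum_fintype _ _ (by simp), Fin.sum_univ_three]
    at e1 e2
  have hW := linearIndependent_of_natural (W := W) h3 hu h0 hne (by simpa using e2) e1
  have hW' : W = Finsupp.mapDomain bottomLetter 0 := by
    rw [Finsupp.mapDomain_zero]
    exact DFunLike.coe_injective hW
  exact Subtype.ext (Finsupp.mapDomain_injective bottomLetter_injective hW')

/-- The lower bound for `λ = (2,1)`, where the minimum is 1. Any 3-cycle on three letters is the
standard one or its square, and both have the same sum. -/
theorem exists_cycSum_eq_zero_specht21 :
    ∃ w : SpechtModule F 3 shape21, w ≠ 0 ∧ cycSum (specht F 3 shape21) (cyc 0 1 2) w = 0 := by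
  have ht : shape21.transpose.card = 3 := by
    rw [← card_shape21]; simp [YoungDiagram.card, YoungDiagram.transpose]
  have hl : min (min (level shape21) (level shape21.transpose)) (3 / 3) = 1 := by
    rw [level, level, YoungDiagram.rowLen_transpose, rowLen_shape21, colLen_shape21, card_shape21,
      ht]
    rfl
  obtain ⟨x, hx, w, hw, h⟩ := exists_triple_min (F := F) card_shape21
  have key (a : Fin (min (min (level shape21) (level shape21.transpose)) (3 / 3))) :
      cycSum (specht F 3 shape21) (cyc 0 1 2) w = 0 := by
    have h := h a
    rcases cyc_perm_three (x (a, 0)) (x (a, 1)) (x (a, 2)) (hx.ne (by simp)) (hx.ne (by simp))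
      (hx.ne (by simp)) with e | e
    · rwa [blockCyc, e] at h
    · rwa [blockCyc, e, cycSum_square (by decide)] at h
  exact ⟨w, hw, key ⟨0, by omega⟩⟩

end Standard

/-! ### The cycles of the standard blocks -/

section Blocks

theorem viaEmbeddingHom_swap {α β : Type*} [DecidableEq α] [DecidableEq β] (f : α ↪ β) (i j : α) :
    Perm.viaEmbeddingHom f (swap i j) = swap (f i) (f j) := by
  ext y
  rw [Perm.viaEmbeddingHom_apply]
  by_cases hy : y ∈ Set.range f
  · obtain ⟨z, rfl⟩ := hy
    rw [Perm.viaEmbedding_apply, f.injective.map_swap]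
  · rw [Perm.viaEmbedding_apply_of_notMem _ _ _ hy, swap_apply_of_ne_of_ne] <;>
      rintro rfl <;> exact hy ⟨_, rfl⟩

theorem viaEmbeddingHom_cyc {α β : Type*} [DecidableEq α] [DecidableEq β] (f : α ↪ β) (i j k : α) :
    Perm.viaEmbeddingHom f (cyc i j k) = cyc (f i) (f j) (f k) := by
  rw [cyc, map_mul, viaEmbeddingHom_swap, viaEmbeddingHom_swap, cyc]

/-- The letters of the consecutive blocks of size three. -/
def blockLetter (n : ℕ) (p : Fin (n / 3) × Fin 3) : Fin n := blockEmb n p.1 p.2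

theorem blockLetter_injective (n : ℕ) : Function.Injective (blockLetter n) := by
  rintro ⟨a, i⟩ ⟨b, j⟩ h
  have h' : 3 * (a : ℕ) + i = 3 * b + j := congrArg Fin.val h
  exact Prod.ext (Fin.ext (by dsimp only; omega)) (Fin.ext (by dsimp only; omega))

theorem factorHom_cyc_coe (n : ℕ) (a : Fin (n / 3)) :
    (factorHom n a (cyc 0 1 2) : Perm (Fin n)) = blockCyc (blockLetter n) a :=
  viaEmbeddingHom_cyc _ _ _ _

theorem cyc_three_pow_three : (cyc 0 1 2 * cyc 0 1 2 * cyc 0 1 2 : Perm (Fin 3)) = 1 := by decide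

theorem factorHom_cyc_pow_three (n : ℕ) (a : Fin (n / 3)) :
    factorHom n a (cyc 0 1 2) * factorHom n a (cyc 0 1 2) * factorHom n a (cyc 0 1 2) = 1 := by
  rw [← map_mul, ← map_mul, cyc_three_pow_three, map_one]

theorem exists_blockEmb_eq {n : ℕ} (g : youngE3 n) (a : Fin (n / 3)) (i : Fin 3) :
    ∃ j, g.1 (blockEmb n a i) = blockEmb n a j := by
  have h := g.2 (blockEmb n a i)
  have hv : ((blockEmb n a i : Fin n) : ℕ) = 3 * a + i := rfl
  refine ⟨⟨(g.1 (blockEmb n a i) : ℕ) - 3 * a, by omega⟩, Fin.ext ?_⟩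
  change _ = 3 * (a : ℕ) + ((g.1 (blockEmb n a i) : ℕ) - 3 * a)
  omega

/-- An element of the Young subgroup permutes the letters of each block, and a block carries only
two 3-cycles. This is why the sum over the powers of the cycle commutes with the whole subgroup. -/
theorem conj_factorHom_cyc {n : ℕ} (g : youngE3 n) (a : Fin (n / 3)) :
    g * factorHom n a (cyc 0 1 2) * g⁻¹ = factorHom n a (cyc 0 1 2) ∨
      g * factorHom n a (cyc 0 1 2) * g⁻¹ =
        factorHom n a (cyc 0 1 2) * factorHom n a (cyc 0 1 2) := by
  obtain ⟨i, hi⟩ := exists_blockEmb_eq g a 0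
  obtain ⟨j, hj⟩ := exists_blockEmb_eq g a 1
  obtain ⟨k, hk⟩ := exists_blockEmb_eq g a 2
  have hinj := g.1.injective.comp (blockEmb n a).injective
  have hij : i ≠ j := by
    rintro rfl
    exact absurd (hinj (hi.trans hj.symm)) (by decide)
  have hik : i ≠ k := by
    rintro rfl
    exact absurd (hinj (hi.trans hk.symm)) (by decide)
  have hjk : j ≠ k := by
    rintro rfl
    exact absurd (hinj (hj.trans hk.symm)) (by decide)
  have hconj : g * factorHom n a (cyc 0 1 2) * g⁻¹ = factorHom n a (cyc i j k) := by
    apply Subtype.ext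
    have h1 : (factorHom n a (cyc 0 1 2) : Perm (Fin n)) =
      cyc (blockEmb n a 0) (blockEmb n a 1) (blockEmb n a 2) := viaEmbeddingHom_cyc _ _ _ _
    have h2 : (factorHom n a (cyc i j k) : Perm (Fin n)) =
      cyc (blockEmb n a i) (blockEmb n a j) (blockEmb n a k) := viaEmbeddingHom_cyc _ _ _ _
    rw [h2, ← hi, ← hj, ← hk, ← conj_cyc, ← h1]
    rfl
  rw [hconj, ← map_mul]
  exact (cyc_perm_three i j k hij hik hjk).imp (congrArg _) (congrArg _)

end Blocks

/-! ### Block sums on irreducible modules of the Young subgroup -/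

section Young

variable {F : Type u} [Field F] {n : ℕ} {L : Type v} [AddCommGroup L] [Module F L]
  (σ : Representation F (youngE3 n) L)

/-- The sum over the powers of the standard cycle of order three in the `a`-th factor. -/
noncomputable def blockSum (a : Fin (n / 3)) : Module.End F L :=
  cycSum σ (factorHom n a (cyc 0 1 2))

theorem blockSum_comm (a : Fin (n / 3)) (g : youngE3 n) (w : L) :
    blockSum σ a (σ g w) = σ g (blockSum σ a w) := by
  rw [blockSum, ← cycSum_conj]
  rcases conj_factorHom_cyc g a with h | h
  · rw [h]
  · rw [h, cycSum_square (factorHom_cyc_pow_three n a)]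

/-- The subrepresentation of the vectors killed by `blockSum σ a` for all `a` in a set. -/
noncomputable def blockKer (A : Set (Fin (n / 3))) : Subrepresentation σ where
  toSubmodule := ⨅ a ∈ A, LinearMap.ker (blockSum σ a)
  apply_mem_toSubmodule g w hw := by
    simp only [Submodule.mem_iInf, LinearMap.mem_ker] at hw ⊢
    intro a ha
    rw [blockSum_comm, hw a ha, map_zero]

theorem mem_blockKer {A : Set (Fin (n / 3))} {w : L} :
    w ∈ (blockKer σ A).toSubmodule ↔ ∀ a ∈ A, blockSum σ a w = 0 := by
  simp [blockKer, Submodule.mem_iInf]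

theorem blockSum_eq_zero_of_irreducible [Representation.IsIrreducible σ] {a : Fin (n / 3)} {w : L}
    (hw : w ≠ 0) (h : blockSum σ a w = 0) : blockSum σ a = 0 := by
  rcases eq_bot_or_eq_top (blockKer σ {a}) with hb | hb
  · have : w ∈ (blockKer σ {a}).toSubmodule := (mem_blockKer σ).2 (by simpa using h)
    rw [hb] at this
    exact absurd ((Submodule.mem_bot F).1 this) hw
  · ext v
    have : v ∈ (blockKer σ {a}).toSubmodule := by
      rw [hb]
      exact Submodule.mem_top
    exact (mem_blockKer σ).1 this a rfl

/-- An embedded `S^(2,1)` provides a nonzero vector killed by the block sum, and by irreducibility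
the kernel of the block sum is then everything. -/
theorem exists_embedding_iff [Nontrivial L] [Representation.IsIrreducible σ] (h3 : (3 : F) ≠ 0)
    (a : Fin (n / 3)) :
    (∃ f : Representation.IntertwiningMap (specht F 3 shape21) (σ.comp (factorHom n a)),
      Function.Injective f) ↔ blockSum σ a = 0 := by
  constructor
  · rintro ⟨f, hf⟩
    obtain ⟨w, hw, h⟩ := exists_cycSum_eq_zero_specht21 (F := F)
    refine blockSum_eq_zero_of_irreducible σ (w := f w) ?_ ?_
    · rw [← map_zero f]
      exact hf.ne hw
    · have e : ∀ v, σ (factorHom n a (cyc 0 1 2)) (f v) = f (specht F 3 shape21 (cyc 0 1 2) v) :=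
        fun v => (Representation.IntertwiningMap.isIntertwining _ _ f (cyc 0 1 2) v).symm
      rw [blockSum, cycSum_apply, e, e, ← map_add, ← map_add]
      exact (congrArg f h).trans (map_zero f)
  · intro h
    exact exists_embedding_specht21 h3 h

end Young

/-! ### Irreducible subrepresentations -/

section Irreducible

variable {F : Type u} [Field F] {G : Type*} [Group G] {V : Type v} [AddCommGroup V] [Module F V]
  {ρ : Representation F G V}

theorem isIrreducible_of_isAtom {B : Subrepresentation ρ} (hB : IsAtom B) :
    Representation.IsIrreducible B.toRepresentation where
  exists_pair_ne := by
    refine ⟨⊥, ⊤, fun h => hB.1 ?_⟩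
    apply Subrepresentation.toSubmodule_injective
    refine (Submodule.eq_bot_iff _).2 fun w hw => ?_
    have h1 : (⟨w, hw⟩ : B.toSubmodule) ∈ (⊤ : Subrepresentation B.toRepresentation).toSubmodule :=
      Submodule.mem_top
    rw [← h] at h1
    exact congrArg Subtype.val ((Submodule.mem_bot F).1 h1)
  eq_bot_or_eq_top C := by
    let D : Subrepresentation ρ :=
      { toSubmodule := C.toSubmodule.map B.toSubmodule.subtype
        apply_mem_toSubmodule := by
          rintro g _ ⟨w, hw, rfl⟩
          exact ⟨B.toRepresentation g w, C.apply_mem_toSubmodule g hw, rfl⟩ }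
    have hDB : D ≤ B := by
      rintro _ ⟨w, _, rfl⟩
      exact w.2
    rcases hB.le_iff.1 hDB with h | h
    · left
      apply Subrepresentation.toSubmodule_injective
      refine (Submodule.eq_bot_iff _).2 fun w hw => ?_
      have h1 : (w : V) ∈ D.toSubmodule := ⟨w, hw, rfl⟩
      rw [h] at h1
      exact Subtype.ext ((Submodule.mem_bot F).1 h1)
    · right
      apply Subrepresentation.toSubmodule_injective
      refine eq_top_iff.2 fun w _ => ?_
      have h1 : (w : V) ∈ D.toSubmodule := by
        rw [h]
        exact w.2
      obtain ⟨w', hw', e⟩ := h1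
      rwa [← Subtype.ext e]

theorem exists_irreducible_le [FiniteDimensional F V] {W : Subrepresentation ρ} (hW : W ≠ ⊥) :
    ∃ B ≤ W, Representation.IsIrreducible B.toRepresentation := by
  have : WellFoundedLT (Subrepresentation ρ) :=
    StrictMono.wellFoundedLT (f := Subrepresentation.toSubmodule) fun _ _ h => h
  have := isAtomic_of_orderBot_wellFounded_lt (α := Subrepresentation ρ) wellFounded_lt
  obtain ⟨B, hB, hle⟩ := (eq_bot_or_exists_atom_le W).resolve_left hW
  exact ⟨B, hle, isIrreducible_of_isAtom hB⟩

end Irreducible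

/-! ### The 3-rank through composition factors -/

section ThreeRank

variable {F : Type u} [Field F] {n r : ℕ} {V : Type v} [AddCommGroup V] [Module F V]
  {ρ : Representation F (Perm (Fin n)) V}

theorem blockSum_restrict (a : Fin (n / 3)) :
    blockSum (ρ.comp (youngE3 n).subtype) a = cycSum ρ (blockCyc (blockLetter n) a) := by
  rw [← factorHom_cyc_coe]
  rfl

theorem commute_blockSum {L : Type v} [AddCommGroup L] [Module F L]
    (σ : Representation F (youngE3 n) L) (a b : Fin (n / 3)) :
    Commute (blockSum σ a) (blockSum σ b) :=
  commute_cycSum_of_commute (LinearMap.ext fun w => blockSum_comm σ a _ w)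

/-- With 3 invertible, `1 - N/3` projects onto the kernel of a block sum `N`. Applied to a preimage
it leaves the image unchanged, since `N` vanishes there; the projections for different blocks
commute. -/
theorem exists_lift_blockSum_eq_zero {V L : Type v} [AddCommGroup V] [Module F V] [AddCommGroup L]
    [Module F L] {ρ : Representation F (youngE3 n) V} {σ : Representation F (youngE3 n) L}
    (h3 : (3 : F) ≠ 0) (f : Representation.IntertwiningMap ρ σ) (v : V) (A : Finset (Fin (n / 3)))
    (hA : ∀ a ∈ A, blockSum σ a (f v) = 0) :
    ∃ w, f w = f v ∧ ∀ a ∈ A, blockSum ρ a w = 0 := by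
  classical
  have hf : ∀ a w, f (blockSum ρ a w) = blockSum σ a (f w) := fun a w => by
    simp only [blockSum, cycSum_apply, map_add, f.isIntertwining]
  induction A using Finset.induction_on with
  | empty => exact ⟨v, rfl, by simp⟩
  | insert b A hb ih =>
    obtain ⟨w, hw, h⟩ := ih fun a ha => hA a (Finset.mem_insert_of_mem ha)
    refine ⟨w - (3 : F)⁻¹ • blockSum ρ b w, ?_, fun a ha => ?_⟩
    · rw [map_sub, map_smul, hf, hw, hA b (Finset.mem_insert_self b A), smul_zero, sub_zero]
    · rw [map_sub, map_smul]
      rcases Finset.mem_insert.1 ha with rfl | ha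
      · rw [← Module.End.mul_apply, blockSum, cycSum_mul_self (factorHom_cyc_pow_three n a),
          LinearMap.smul_apply, inv_smul_smul₀ h3, sub_self]
      · rw [← Module.End.mul_apply, (commute_blockSum ρ a b).eq, Module.End.mul_apply, h a ha,
          map_zero, smul_zero, sub_zero]

/-- A nonzero vector of the composition factor lifts to one of `V` killed by the sums of all blocks
counted by the type, and `upper` applies to these blocks. -/
theorem typeE3_le {L : Type v} [AddCommGroup L] [Module F L] {σ : Representation F (youngE3 n) L}
    (h3 : (3 : F) ≠ 0)
    (upper : ∀ (s : ℕ) (x : Fin s × Fin 3 → Fin n), Function.Injective x → ∀ w : V, w ≠ 0 →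
      (∀ a, cycSum ρ (blockCyc x a) w = 0) → s ≤ r)
    (h : IsCompositionFactor σ (ρ.comp (youngE3 n).subtype)) : typeE3 σ ≤ r := by
  classical
  obtain ⟨hσ, B, f, hf⟩ := h
  have hL : Nontrivial L := by
    by_contra hL
    rw [not_nontrivial_iff_subsingleton] at hL
    have hs : Subsingleton (Subrepresentation σ) :=
      Subrepresentation.toSubmodule_injective.subsingleton
    obtain ⟨x, y, hxy⟩ := hσ.exists_pair_ne
    exact hxy (Subsingleton.elim x y)
  obtain ⟨l, hl⟩ := exists_ne (0 : L)
  obtain ⟨v, rfl⟩ := hf l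
  unfold typeE3
  simp only [exists_embedding_iff σ h3]
  obtain ⟨w, hw, hw0⟩ := exists_lift_blockSum_eq_zero h3 f v
    (Finset.univ.filter fun a => blockSum σ a = 0) (fun a ha => by
      rw [(Finset.mem_filter.1 ha).2, LinearMap.zero_apply])
  rw [Nat.card_eq_fintype_card]
  set A := {a : Fin (n / 3) // blockSum σ a = 0}
  let e : Fin (Fintype.card A) ≃ A := (Fintype.equivFin A).symm
  refine upper _ (fun p => blockLetter n ((e p.1).1, p.2)) ?_ w.1 ?_ ?_
  · rintro ⟨a, i⟩ ⟨b, j⟩ hab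
    have := Prod.ext_iff.1 (blockLetter_injective n hab)
    exact Prod.ext (e.injective (Subtype.ext this.1)) this.2
  · intro h0
    apply hl
    rw [← hw, show w = 0 from Subtype.ext h0, map_zero]
  · intro a
    have h1 := congrArg Subtype.val (hw0 (e a).1 (by simpa using (e a).2))
    have h2 : blockSum (ρ.comp (youngE3 n).subtype) (e a).1 w.1 = 0 := h1
    rw [blockSum_restrict] at h2
    exact h2

/-- All families of `r` disjoint triples are conjugate, so a translate of the vector works for the
first `r` blocks. -/
theorem exists_vector_blockSum (hle : r ≤ n / 3) {x : Fin r × Fin 3 → Fin n}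
    (hx : Function.Injective x) {w : V} (hw : w ≠ 0) (h : ∀ a, cycSum ρ (blockCyc x a) w = 0) :
    ∃ w : V, w ≠ 0 ∧ ∀ a : Fin (n / 3), (a : ℕ) < r →
      blockSum (ρ.comp (youngE3 n).subtype) a w = 0 := by
  obtain ⟨g, hg⟩ := Perm.exists_extending_pair x
    (fun p => blockLetter n (Fin.castLE hle p.1, p.2)) hx (by
      rintro ⟨a, i⟩ ⟨b, j⟩ hab
      have := Prod.ext_iff.1 (blockLetter_injective n hab)
      exact Prod.ext (Fin.castLE_injective hle this.1) this.2)
  refine ⟨ρ g w, fun h0 => hw ?_, fun a ha => ?_⟩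
  · have : ρ g⁻¹ (ρ g w) = w := by
      rw [← Module.End.mul_apply, ← map_mul, inv_mul_cancel, map_one, Module.End.one_apply]
    rw [← this, h0, map_zero]
  · have e : g * blockCyc x ⟨a, ha⟩ * g⁻¹ = blockCyc (blockLetter n) a := by
      rw [blockCyc, conj_cyc, hg, hg, hg]
      rfl
    rw [blockSum_restrict, ← e, cycSum_conj, h, map_zero]

theorem isThreeRank_of_triples [FiniteDimensional F V] (h3 : (3 : F) ≠ 0) (hle : r ≤ n / 3)
    (lower : ∃ x : Fin r × Fin 3 → Fin n, Function.Injective x ∧ ∃ w : V, w ≠ 0 ∧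
      ∀ a, cycSum ρ (blockCyc x a) w = 0)
    (upper : ∀ (s : ℕ) (x : Fin s × Fin 3 → Fin n), Function.Injective x → ∀ w : V, w ≠ 0 →
      (∀ a, cycSum ρ (blockCyc x a) w = 0) → s ≤ r) : IsThreeRank ρ r := by
  constructor
  · obtain ⟨x, hx, w, hw, h⟩ := lower
    obtain ⟨w, hw, h⟩ := exists_vector_blockSum hle hx hw h
    let W := blockKer (ρ.comp (youngE3 n).subtype) {a | (a : ℕ) < r}
    have hwW : w ∈ W.toSubmodule := (mem_blockKer _).2 h
    have hW : W ≠ ⊥ := fun h0 => by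
      rw [h0] at hwW
      exact hw ((Submodule.mem_bot F).1 hwW)
    -- An irreducible subrepresentation of the common kernel of the first `r` block sums has type at
    -- least `r`.
    obtain ⟨B, hBW, hB⟩ := exists_irreducible_le hW
    have hcomp : IsCompositionFactor B.toRepresentation (ρ.comp (youngE3 n).subtype) :=
      ⟨hB, B, LinearMap.id.intertwiningMap_of_isIntertwiningMap _ _ fun _ _ => rfl,
        fun x => ⟨x, rfl⟩⟩
    refine ⟨_, _, _, B.toRepresentation, hcomp, le_antisymm ?_ (typeE3_le h3 upper hcomp)⟩
    have hL : Nontrivial B.toSubmodule := by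
      by_contra hL
      rw [not_nontrivial_iff_subsingleton] at hL
      have hs : Subsingleton (Subrepresentation B.toRepresentation) :=
        Subrepresentation.toSubmodule_injective.subsingleton
      obtain ⟨x, y, hxy⟩ := hB.exists_pair_ne
      exact hxy (Subsingleton.elim x y)
    unfold typeE3
    simp only [exists_embedding_iff B.toRepresentation h3]
    have hker : ∀ a : Fin r, blockSum B.toRepresentation (Fin.castLE hle a) = 0 := fun a => by
      ext v
      exact congrArg Subtype.val (Subtype.ext ((mem_blockKer _).1 (hBW v.2) (Fin.castLE hle a) a.2) :
        blockSum B.toRepresentation (Fin.castLE hle a) v = 0)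
    have := Nat.card_le_card_of_injective
      (fun a : Fin r => (⟨Fin.castLE hle a, hker a⟩ :
        {a : Fin (n / 3) // blockSum B.toRepresentation a = 0}))
      (fun a b hab => Fin.castLE_injective hle (Subtype.ext_iff.1 hab))
    simpa using this
  · rintro s ⟨L, _, _, σ, hσ, rfl⟩
    exact typeE3_le h3 upper hσ

theorem isThreeRank_specht {μ : YoungDiagram} (h3 : (3 : F) ≠ 0) (hμ : μ.card = n) :
    IsThreeRank (V := SpechtModule F n μ) (specht F n μ)
      (min (min (level μ) (level μ.transpose)) (n / 3)) :=
  have : FiniteDimensional F (SpechtModule F n μ) :=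
    FiniteDimensional.finiteDimensional_submodule (spechtSub F n μ).toSubmodule
  isThreeRank_of_triples (V := SpechtModule F n μ) h3 (min_le_right _ _) (exists_triple_min hμ)
    fun _ _ hx _ hw h => triple_le_min h3 hx hw h

end ThreeRank

end SymmetricRank

theorem proposition3p5 {F : Type*} [Field F] (p : ℕ) [CharP F p] (n : ℕ)
    (μ : YoungDiagram) (hμ : μ.card = n) :
    (p ≠ 2 →
      SymmetricRank.IsTwoRank (V := SymmetricRank.SpechtModule F n μ)
        (SymmetricRank.specht F n μ)
        (min (SymmetricRank.level μ) (n / 2))) ∧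
    (p ≠ 3 →
      (∀ ζ : F, IsPrimitiveRoot ζ 3 →
        SymmetricRank.IsThreeRankAt (V := SymmetricRank.SpechtModule F n μ) ζ
          (SymmetricRank.specht F n μ)
          (min (min (SymmetricRank.level μ) (SymmetricRank.level μ.transpose)) (n / 3))) ∧
      SymmetricRank.IsThreeRank (V := SymmetricRank.SpechtModule F n μ)
        (SymmetricRank.specht F n μ)
        (min (min (SymmetricRank.level μ) (SymmetricRank.level μ.transpose)) (n / 3))) := by
  -- A characteristic dividing the prime `q` is 1 or `q`, and a field never has characteristic 1;
  -- this covers `p = 0` too.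
  have prime_ne_zero : ∀ q : ℕ, q.Prime → p ≠ q → (q : F) ≠ 0 := fun q hq hpq h =>
    (hq.eq_one_or_self_of_dvd p ((CharP.cast_eq_zero_iff F p q).1 h)).elim
      (CharP.char_ne_one F p) hpq
  refine ⟨fun h2 => SymmetricRank.isTwoRank_specht
    (by exact_mod_cast prime_ne_zero 2 Nat.prime_two h2) hμ, fun h3 => ?_⟩
  have h3' : (3 : F) ≠ 0 := by exact_mod_cast prime_ne_zero 3 Nat.prime_three h3
  exact ⟨fun ζ hζ => SymmetricRank.isThreeRankAt_specht h3' hζ hμ,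
    SymmetricRank.isThreeRank_specht h3' hμ⟩
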